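/- All graphs are finite and simple. The rook's graph $K_m\square K_n$ has the vertices $v_{r,c}$ ($1\le r\le m$, $1\le c\le n$), two distinct vertices being adjacent iff they agree in the row $r$ or in the column $c$. A \emph{triangulation} of a graph $G=(V,E)$ is a chordal graph $H=(V,E_H)$ with $E\subseteq E_H$; the edges in $E_H\setminus E$ are its \emph{fill edges}, and $H$ is a \emph{minimum} triangulation if no triangulation of $G$ has fewer edges. Write $\mathrm{tw}$ for treewidth and $$\tau(G)=\min\{\mathrm{tw}(H) : H \text{ is a minimum triangulation of } G\}-\mathrm{tw}(G).$$ For an ordering $\beta$ of $V$, let $G^+_\beta$ be the graph obtained from $G$ by adding all edges that arise when the vertices are eliminated in the order $\beta$, where eliminating a vertex means making its current neighbours pairwise adjacent and then deleting it. \textbf{Lemma.} Let $G=K_4\square K_5$. Then $\tau(G)=0$; that is, $G$ has a minimum triangulation $H$ with $\mathrm{tw}(H)=\mathrm{tw}(G)$. Moreover $\mathrm{tw}(G)=11$, and for every ordering $\beta$ of $V$ that begins with $$v_{1,1},\,v_{2,2},\,v_{3,3},\,v_{4,4},\,v_{1,2},\,v_{3,4},\,v_{2,1},\,v_{4,3},$$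 the graph $G^+_\beta$ is a triangulation of $G$ with treewidth $11$ and exactly $66$ fill edges, and every triangulation $H$ of $G$ with $\mathrm{tw}(H)>11$ has at least as many edges as $G^+_\beta$. -/

import Mathlib

namespace SimpleGraph

/-- The `m × n` rook's graph `K_m □ K_n`. The vertex `v_{r,c}` (row `r`, column `c`, numbered from
`1`) is the pair `(r - 1, c - 1)`. -/
def rookGraph (m n : ℕ) : SimpleGraph (Fin m × Fin n) :=
  boxProd (completeGraph (Fin m)) (completeGraph (Fin n))

variable {V : Type*}

/-- A tree decomposition of `G`, with the nodes of the tree numbered `0, …, n - 1`. -/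
structure TreeDecomposition (G : SimpleGraph V) where
  n : ℕ
  tree : SimpleGraph (Fin n)
  isTree : tree.IsTree
  bag : Fin n → Finset V
  /-- Both ends of every edge lie in a common bag. -/
  edge_mem : ∀ u v : V, G.Adj u v → ∃ t : Fin n, u ∈ bag t ∧ v ∈ bag t
  /-- The nodes whose bags contain a given vertex induce a (nonempty) connected subtree. -/
  connected : ∀ v : V, (tree.induce {t : Fin n | v ∈ bag t}).Connected

/-- The treewidth of a finite graph: the least `k` such that some tree decomposition has all of its
bags of size at most `k + 1`. -/
noncomputable def treewidth (G : SimpleGraph V) : ℕ :=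
  sInf {k : ℕ | ∃ D : TreeDecomposition G, ∀ t : Fin D.n, (D.bag t).card ≤ k + 1}

/-- Every cycle of length at least four has a chord. -/
def IsChordalGraph (G : SimpleGraph V) : Prop :=
  ∀ (v : V) (c : G.Walk v v), c.IsCycle → 4 ≤ c.length →
    ∃ x ∈ c.support, ∃ y ∈ c.support, G.Adj x y ∧ s(x, y) ∉ c.edges

/-- `H` is a triangulation of `G`: a chordal supergraph on the same vertices. -/
def IsTriangulation (G H : SimpleGraph V) : Prop :=
  G ≤ H ∧ IsChordalGraph H

/-- The number of edges of a finite graph. -/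
noncomputable def numEdges (G : SimpleGraph V) : ℕ :=
  G.edgeSet.ncard

/-- `H` is a minimum triangulation of `G`: a triangulation with the fewest edges. -/
def IsMinimumTriangulation (G H : SimpleGraph V) : Prop :=
  IsTriangulation G H ∧ ∀ H' : SimpleGraph V, IsTriangulation G H' → numEdges H ≤ numEdges H'

/-- The parameter `τ(G)` of a finite graph: the difference between the least treewidth of a minimum
triangulation of `G` and the treewidth of `G`. -/
noncomputable def tau (G : SimpleGraph V) : ℤ :=
  (sInf {k : ℕ | ∃ H : SimpleGraph V, IsMinimumTriangulation G H ∧ treewidth H = k} : ℕ) -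
    (treewidth G : ℤ)

/-- Elimination of the vertex `v`: its neighbours are made pairwise adjacent and `v` is removed.
The vertex set is kept, so that a removed vertex stays behind as an isolated one. -/
def eliminate (G : SimpleGraph V) (v : V) : SimpleGraph V where
  Adj x y := x ≠ y ∧ x ≠ v ∧ y ≠ v ∧ (G.Adj x y ∨ (G.Adj x v ∧ G.Adj v y))
  symm := ⟨fun _ _ h => ⟨h.1.symm, h.2.2.1, h.2.1,
    h.2.2.2.imp (fun e => e.symm) (fun e => ⟨e.2.symm, e.1.symm⟩)⟩⟩
  loopless := ⟨fun _ h => h.1 rfl⟩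

/-- An elimination ordering: a list in which every vertex occurs exactly once. -/
def IsEliminationOrdering (l : List V) : Prop :=
  l.Nodup ∧ ∀ v : V, v ∈ l

/-- The graph `G⁺_l` obtained from `G` by adding all the edges that appear while the vertices are
eliminated in the order of the list `l`. -/
def eliminationGraph (G : SimpleGraph V) : List V → SimpleGraph V
  | [] => G
  | v :: l => G ⊔ eliminationGraph (eliminate G v) l

/-- The number of fill edges of a supergraph `H` of `G`: edges of `H` that are not edges of `G`. -/
noncomputable def numFillEdges (G H : SimpleGraph V) : ℕ :=
  (H.edgeSet \ G.edgeSet).ncard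

end SimpleGraph

/-!
The argument passes between triangulations, tree decompositions and perfect elimination orders. By
Dirac's theorem (`IsChordalGraph.exists_isPerfectElimination`) a chordal graph has a perfect
elimination order, and any prescribed clique can be placed at its end. The number of edges is the
sum of the numbers of later neighbours. If these numbers are all at most `k`, the treewidth is at
most `k` (`IsPerfectElimination.treewidth_le`); conversely a tree decomposition of width `k` gives a
chordal supergraph with such an order (`TreeDecomposition.exists_isPerfectElimination`).

For a rook's graph, the cost of eliminating a cell `v`, its number of later neighbours, is bounded
below by a union-find count on the lines, that is, on the rows and columns. Each eliminated cell
links its row to its column, and eliminating `v` makes all the remaining cells on the lines linked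
to `v` neighbours of `v`. If `r` rows and `q` columns are linked to `v`, with `c` cells up to and
including `v` on them, then in the `4 × 5` case the cost is at least `5 r + 4 q - r q - c`
(`IsPerfectElimination.le_card_laterNeighbors`).

* The treewidth is at least 11. At the first step that links four or more lines one has
  `c ≤ r + q - 1`, and the cost of this step is at least 11.
* A triangulation of treewidth above 11 has at least 136 edges. It contains a clique of 13 vertices,
  which has 78 edges and can be placed last. The seven cells before it cost at least 58 in total
  (`IsPerfectElimination.le_sum_card_laterNeighbors`): at least 7 for a cell with a new row and column,
  at least 9 for one with just a new column, and at least 10 for any other. New columns occur at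
  most five times and new rows at most four times, which gives 57; equality is excluded, because the
  first cell in an old column would then cost at least 11.
* After the eight prescribed cells, the remaining twelve are pairwise adjacent, so that the
  elimination graph does not depend on the rest of the ordering. It has 136 = 70 + 66 edges and
  treewidth 11.

So either some minimum triangulation has treewidth 11, or a minimum triangulation has at least 136
edges, and then the elimination graph is itself a minimum triangulation.
-/

namespace SimpleGraph

/-! ### Elimination orders -/

/-- If every vertex set properly containing `K` has a vertex outside `K` that stands in the relation
`Q` to the rest of the set, removing such vertices one by one orders the vertices, with `K` last and
every vertex outside `K` in the relation `Q` to the set of its successors. -/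
theorem exists_elimination_order {V : Type*} [Fintype V] [DecidableEq V] (K : Finset V)
    (Q : V → Finset V → Prop)
    (h : ∀ W : Finset V, K ⊂ W → ∃ v ∈ W, v ∉ K ∧ Q v (W.erase v)) :
    ∃ pos : V → ℕ, Function.Injective pos ∧ (∀ v ∈ K, ∀ w ∉ K, pos w < pos v) ∧
      ∀ v ∉ K, Q v (Finset.univ.filter fun w => pos v < pos w) := by
  have key : ∀ n : ℕ, ∀ W : Finset V, W.card = n → K ⊆ W → ∃ pos : V → ℕ,
      Set.InjOn pos W ∧ (∀ v ∈ K, ∀ w ∈ W, w ∉ K → pos w < pos v) ∧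
      ∀ v ∈ W, v ∉ K → Q v (W.filter fun w => pos v < pos w) := by
    intro n
    induction n with
    | zero =>
      intro W hW hK
      rw [Finset.card_eq_zero] at hW
      subst hW
      exact ⟨fun _ => 0, by simp, by simp, by simp⟩
    | succ n ih =>
      intro W hW hK
      rcases hK.eq_or_ssubset with rfl | hKW
      · refine ⟨fun v => (Fintype.equivFin V v : ℕ), ?_, fun v _ w h1 h2 => (h2 h1).elim,
          fun v h1 h2 => (h2 h1).elim⟩
        intro a _ b _ hab
        exact (Fintype.equivFin V).injective (Fin.ext hab)
      · obtain ⟨v, hvW, hvK, hQ⟩ := h W hKW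
        obtain ⟨pos, hinj, hlast, hpos⟩ := ih (W.erase v)
          (by rw [Finset.card_erase_of_mem hvW, hW]; rfl)
          (fun x hx => Finset.mem_erase.2 ⟨fun e => hvK (e ▸ hx), hK hx⟩)
        refine ⟨fun x => if x = v then 0 else pos x + 1, ?_, ?_, ?_⟩
        · intro a ha b hb hab
          by_cases hav : a = v <;> by_cases hbv : b = v
          · rw [hav, hbv]
          · simp [hav, hbv] at hab
          · simp [hav, hbv] at hab
          · simp only [hav, hbv, if_false, Nat.add_right_cancel_iff] at hab
            exact hinj (by simpa [hav] using ha) (by simpa [hbv] using hb) hab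
        · intro a ha w hw hwK
          have hav : a ≠ v := fun e => hvK (e ▸ ha)
          by_cases hwv : w = v
          · simp [hav, hwv]
          · simpa [hav, hwv] using hlast a ha w (Finset.mem_erase.2 ⟨hwv, hw⟩) hwK
        · intro a ha haK
          by_cases hav : a = v
          · subst hav
            convert hQ using 1
            ext w
            by_cases hwv : w = a <;> simp [hwv]
          · convert hpos a (Finset.mem_erase.2 ⟨hav, ha⟩) haK using 1
            ext w
            by_cases hwv : w = v <;> simp [hwv, hav]
  obtain ⟨pos, h1, h2, h3⟩ := key _ Finset.univ rfl (Finset.subset_univ K)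
  exact ⟨pos, fun a b hab => h1 (by simp) (by simp) hab,
    fun v hv w hw => h2 v hv w (Finset.mem_univ _) hw, fun v hv => h3 v (Finset.mem_univ _) hv⟩

/-- `pos` numbers the vertices injectively in a perfect elimination order of `H`: the neighbours
of a vertex that come after it are pairwise adjacent. -/
def IsPerfectElimination {V : Type*} (H : SimpleGraph V) (pos : V → ℕ) : Prop :=
  Function.Injective pos ∧ ∀ v x y : V, H.Adj v x → H.Adj v y → pos v < pos x → pos v < pos y →
    x ≠ y → H.Adj x y

open Classical in
/-- The neighbours of `v` that come after `v` in the order given by `pos`. -/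
noncomputable def laterNeighbors {V : Type*} [Fintype V] (H : SimpleGraph V) (pos : V → ℕ)
    (v : V) : Finset V :=
  Finset.univ.filter fun w => H.Adj v w ∧ pos v < pos w

theorem mem_laterNeighbors {V : Type*} [Fintype V] {H : SimpleGraph V} {pos : V → ℕ} {v w : V} :
    w ∈ laterNeighbors H pos v ↔ H.Adj v w ∧ pos v < pos w := by
  simp [laterNeighbors]

/-! ### Chordal graphs have perfect elimination orders -/

/-- A shortest walk within `S` is a chordless path. -/
theorem exists_isPath_isChordless {V : Type*} {H : SimpleGraph V} {S : Set V} {s t : V}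
    (h : ∃ p : H.Walk s t, ∀ z ∈ p.support, z ∈ S) :
    ∃ p : H.Walk s t, p.IsPath ∧ p.IsChordless ∧ ∀ z ∈ p.support, z ∈ S := by
  classical
  have hex : ∃ n : ℕ, ∃ p : H.Walk s t, p.length = n ∧ ∀ z ∈ p.support, z ∈ S := by
    obtain ⟨p, hp⟩ := h
    exact ⟨_, p, rfl, hp⟩
  obtain ⟨p, hpn, hpS⟩ := Nat.find_spec hex
  have hmin : ∀ q : H.Walk s t, (∀ z ∈ q.support, z ∈ S) → p.length ≤ q.length := by
    intro q hq
    rw [hpn]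
    exact Nat.find_min' hex ⟨q, rfl, hq⟩
  have hbS : ∀ z ∈ p.bypass.support, z ∈ S :=
    fun z hz => hpS z (p.support_bypass_subset_support hz)
  have hbl : p.bypass.length = p.length :=
    le_antisymm p.length_bypass_le_length (hmin _ hbS)
  refine ⟨p.bypass, p.bypass_isPath, ?_, hbS⟩
  rw [← hbl] at hmin
  generalize p.bypass = q at hbS hmin
  have main : ∀ i j : ℕ, i < j → j ≤ q.length → H.Adj (q.getVert i) (q.getVert j) →
      s(q.getVert i, q.getVert j) ∈ q.edges := by
    intro i j hij hj hadj
    have := hmin ((q.take i).append (Walk.cons hadj (q.drop j))) (by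
      intro z hz
      rw [Walk.mem_support_append_iff, Walk.support_cons, List.mem_cons] at hz
      rcases hz with hz | rfl | hz
      · exact hbS z ((q.isSubwalk_take i).support_subset hz)
      · exact hbS _ (q.getVert_mem_support i)
      · exact hbS z ((q.isSubwalk_drop j).support_subset hz))
    rw [Walk.length_append, Walk.length_cons, Walk.take_length, Walk.drop_length] at this
    obtain rfl : j = i + 1 := by omega
    exact (Walk.mk_mem_edges_iff_exists q).2 ⟨i, by omega, rfl⟩
  rw [Walk.isChordless_iff_forall_mem_edges]
  intro x y hx hy hxy
  obtain ⟨i, rfl, hi⟩ := Walk.mem_support_iff_exists_getVert.1 hx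
  obtain ⟨j, rfl, hj⟩ := Walk.mem_support_iff_exists_getVert.1 hy
  rcases lt_trichotomy i j with hij | rfl | hij
  · exact main i j hij hj hxy
  · exact (H.loopless.irrefl _ hxy).elim
  · rw [Sym2.eq_swap]
    exact main j i hij hi hxy.symm

/-- A chordless path between `s` and `t` through `C` closes up through `x` to a cycle all of whose
chords would have to be incident with `x`. -/
theorem IsChordalGraph.adj_of_common_neighbor {V : Type*} {H : SimpleGraph V}
    (hH : IsChordalGraph H) {C : Set V} {x s t : V} (hxs : H.Adj x s) (hxt : H.Adj x t)
    (hst : s ≠ t) (hxC : x ∉ C) (hC : ∀ c ∈ C, ¬ H.Adj x c)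
    (h : ∃ p : H.Walk s t, ∀ z ∈ p.support, z = s ∨ z = t ∨ z ∈ C) : H.Adj s t := by
  by_contra hadj
  obtain ⟨p, hp, hch, hpS⟩ :=
    exists_isPath_isChordless (S := {z | z = s ∨ z = t ∨ z ∈ C}) h
  have hxp : x ∉ p.support := by
    intro hx
    rcases hpS x hx with h1 | h1 | h1
    · exact hxs.ne h1
    · exact hxt.ne h1
    · exact hxC h1
  have hlen : 2 ≤ p.length := by
    by_contra hlt
    have h01 : p.length = 0 ∨ p.length = 1 := by omega
    rcases h01 with h0 | h1
    · exact hst (Walk.eq_of_length_eq_zero h0)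
    · exact hadj (Walk.adj_of_length_eq_one h1)
  have hcyc : (Walk.cons hxs (p.concat hxt.symm)).IsCycle := by
    rw [Walk.cons_isCycle_iff]
    refine ⟨hp.concat hxp _, ?_⟩
    rw [Walk.edges_concat, List.concat_eq_append, List.mem_append, List.mem_singleton]
    rintro (h1 | h1)
    · exact hxp (p.fst_mem_support_of_mem_edges h1)
    · rw [Sym2.eq_iff] at h1
      rcases h1 with ⟨h1, -⟩ | ⟨-, h1⟩
      · exact hxt.ne h1
      · exact hst h1
  obtain ⟨a, ha, b, hb, hab, hnot⟩ := hH x _ hcyc (by simp; omega)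
  have hmem : ∀ z, z ∈ (Walk.cons hxs (p.concat hxt.symm)).support → z = x ∨ z ∈ p.support := by
    intro z hz
    simpa [Walk.support_concat, or_comm] using hz
  have hedge : ∀ e, e ∈ (Walk.cons hxs (p.concat hxt.symm)).edges ↔
      e = s(x, s) ∨ e ∈ p.edges ∨ e = s(t, x) := by
    intro e
    rw [Walk.edges_cons, Walk.edges_concat, List.mem_cons, List.concat_eq_append, List.mem_append,
      List.mem_singleton]
  rw [hedge] at hnot
  push Not at hnot
  obtain ⟨hn1, hn2, hn3⟩ := hnot
  have hx_end : ∀ z ∈ p.support, H.Adj x z → z = s ∨ z = t := by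
    intro z hz hxz
    rcases hpS z hz with h1 | h1 | h1
    · exact Or.inl h1
    · exact Or.inr h1
    · exact (hC z h1 hxz).elim
  rcases hmem a ha with rfl | ha'
  · rcases hmem b hb with rfl | hb'
    · exact hab.ne rfl
    · rcases hx_end b hb' hab with rfl | rfl
      · exact hn1 rfl
      · exact hn3 Sym2.eq_swap
  · rcases hmem b hb with rfl | hb'
    · rcases hx_end a ha' hab.symm with rfl | rfl
      · exact hn1 Sym2.eq_swap
      · exact hn3 rfl
    · exact hn2 (hch.mem_edges ha' hb' hab)

/-- Dirac's theorem in a relative form: in the subgraph induced on `W`, some vertex outside the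
clique `K` is simplicial. -/
theorem IsChordalGraph.exists_simplicial_notMem {V : Type*} {H : SimpleGraph V}
    (hH : IsChordalGraph H) (W K : Finset V) (hKW : K ⊂ W)
    (hK : H.IsClique (K : Set V)) :
    ∃ v ∈ W, v ∉ K ∧ ∀ a ∈ W, ∀ b ∈ W, H.Adj v a → H.Adj v b → a ≠ b → H.Adj a b := by
  classical
  induction hn : W.card using Nat.strong_induction_on generalizing W K with
  | _ n ih =>
  subst hn
  -- For a vertex `x` with a non-neighbour `u`, the component `C` of `u` off the closed neighbourhood
  -- of `x` is attached to a clique `S` of neighbours of `x`, and `C ∪ S` is smaller than `W`.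
  have nonuniversal : ∀ x ∈ W, ∀ u ∈ W, u ≠ x → ¬ H.Adj x u → ∃ y ∈ W, y ≠ x ∧ ¬ H.Adj x y ∧
      ∀ a ∈ W, ∀ b ∈ W, H.Adj y a → H.Adj y b → a ≠ b → H.Adj a b := by
    intro x hx u hu hux hxu
    set C : Finset V := W.filter fun z =>
      ∃ p : H.Walk u z, ∀ a ∈ p.support, a ∈ W ∧ a ≠ x ∧ ¬ H.Adj x a
    set S : Finset V := W.filter fun s => H.Adj x s ∧ ∃ c ∈ C, H.Adj c s
    have hCprop : ∀ c ∈ C, c ∈ W ∧ c ≠ x ∧ ¬ H.Adj x c := by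
      intro c hc
      obtain ⟨p, hp⟩ := (Finset.mem_filter.1 hc).2
      exact hp c p.end_mem_support
    have huC : u ∈ C := Finset.mem_filter.2 ⟨hu, Walk.nil, by simp [hu, hux, hxu]⟩
    have hwalk : ∀ c ∈ C, ∃ p : H.Walk u c, ∀ a ∈ p.support, a ∈ C := by
      intro c hc
      obtain ⟨p, hp⟩ := (Finset.mem_filter.1 hc).2
      refine ⟨p, fun a ha => Finset.mem_filter.2 ⟨(hp a ha).1, p.takeUntil a ha, fun b hb => ?_⟩⟩
      exact hp b (p.support_takeUntil_subset_support ha hb)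
    have hSclique : H.IsClique (S : Set V) := by
      intro s hs t ht hst
      obtain ⟨-, hxs, c, hc, hcs⟩ := Finset.mem_filter.1 hs
      obtain ⟨-, hxt, d, hd, hdt⟩ := Finset.mem_filter.1 ht
      refine hH.adj_of_common_neighbor (C := (C : Set V)) hxs hxt hst
        (fun h => (hCprop x h).2.1 rfl) (fun c hc => (hCprop c hc).2.2) ?_
      obtain ⟨p, hp⟩ := hwalk c hc
      obtain ⟨q, hq⟩ := hwalk d hd
      refine ⟨Walk.cons hcs.symm ((p.reverse.append q).concat hdt), fun z hz => ?_⟩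
      simp only [Walk.support_cons, Walk.support_concat, List.mem_cons, List.mem_append,
        Walk.mem_support_append_iff, Walk.support_reverse, List.mem_reverse,
        List.not_mem_nil, or_false] at hz
      rcases hz with h1 | (h1 | h1) | h1
      · exact Or.inl h1
      · exact Or.inr (Or.inr (hp z h1))
      · exact Or.inr (Or.inr (hq z h1))
      · exact Or.inr (Or.inl h1)
    have huS : u ∉ S := fun h => hxu (Finset.mem_filter.1 h).2.1
    have hsub : C ∪ S ⊂ W := by
      refine ⟨Finset.union_subset (Finset.filter_subset _ _) (Finset.filter_subset _ _), ?_⟩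
      intro h
      rcases Finset.mem_union.1 (h hx) with h1 | h1
      · exact (hCprop x h1).2.1 rfl
      · exact (Finset.mem_filter.1 h1).2.1.ne rfl
    obtain ⟨y, hy, hyS, hsimp⟩ := ih _ (Finset.card_lt_card hsub) (C ∪ S) S
      ⟨Finset.subset_union_right, fun h => huS (h (Finset.mem_union_left _ huC))⟩ hSclique rfl
    have hyC : y ∈ C := (Finset.mem_union.1 hy).resolve_right hyS
    have hnbr : ∀ a ∈ W, H.Adj y a → a ∈ C ∪ S := by
      intro a ha hya
      by_cases hxa : H.Adj x a
      · exact Finset.mem_union_right _ (Finset.mem_filter.2 ⟨ha, hxa, y, hyC, hya⟩)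
      · have hax : a ≠ x := by
          rintro rfl
          exact (hCprop y hyC).2.2 hya.symm
        obtain ⟨p, hp⟩ := hwalk y hyC
        refine Finset.mem_union_left _ (Finset.mem_filter.2 ⟨ha, p.concat hya, fun b hb => ?_⟩)
        rw [Walk.support_concat, List.mem_append, List.mem_singleton] at hb
        rcases hb with hb | rfl
        · exact hCprop b (hp b hb)
        · exact ⟨ha, hax, hxa⟩
    exact ⟨y, (hCprop y hyC).1, (hCprop y hyC).2.1, (hCprop y hyC).2.2,
      fun a ha b hb hya hyb => hsimp a (hnbr a ha hya) b (hnbr b hb hyb) hya hyb⟩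
  by_cases hcomplete : ∀ x ∈ W, ∀ u ∈ W, u ≠ x → H.Adj x u
  · obtain ⟨v, hv, hvK⟩ := Finset.exists_of_ssubset hKW
    exact ⟨v, hv, hvK, fun a ha b hb _ _ hab => hcomplete a ha b hb hab.symm⟩
  · by_cases hKuniv : ∀ k ∈ K, ∀ u ∈ W, u ≠ k → H.Adj k u
    · push Not at hcomplete
      obtain ⟨x, hx, u, hu, hux, hxu⟩ := hcomplete
      obtain ⟨y, hy, hyx, hxy, hs⟩ := nonuniversal x hx u hu hux hxu
      exact ⟨y, hy, fun hyK => hxy (hKuniv y hyK x hx hyx.symm).symm, hs⟩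
    · push Not at hKuniv
      obtain ⟨k, hk, u, hu, huk, hku⟩ := hKuniv
      obtain ⟨y, hy, hyk, hky, hs⟩ := nonuniversal k (hKW.1 hk) u hu huk hku
      exact ⟨y, hy, fun hyK => hky (hK hk hyK hyk.symm), hs⟩

/-- Any clique of a chordal graph can be placed at the end of a perfect elimination order. -/
theorem IsChordalGraph.exists_isPerfectElimination {V : Type*} [Fintype V] {H : SimpleGraph V}
    (hH : IsChordalGraph H) (K : Finset V) (hK : H.IsClique (K : Set V)) :
    ∃ pos : V → ℕ, IsPerfectElimination H pos ∧ ∀ v ∈ K, ∀ w ∉ K, pos w < pos v := by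
  classical
  obtain ⟨pos, hinj, hlast, hpos⟩ := exists_elimination_order K
    (fun v W => ∀ a ∈ W, ∀ b ∈ W, H.Adj v a → H.Adj v b → a ≠ b → H.Adj a b) (by
      intro W hW
      obtain ⟨v, hv, hvK, h⟩ := hH.exists_simplicial_notMem W K hW hK
      exact ⟨v, hv, hvK, fun a ha b hb =>
        h a (Finset.mem_of_mem_erase ha) b (Finset.mem_of_mem_erase hb)⟩)
  refine ⟨pos, ⟨hinj, fun v x y hx hy hpx hpy hxy => ?_⟩, hlast⟩
  by_cases hv : v ∈ K
  · have hup : ∀ z, pos v < pos z → z ∈ K := by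
      intro z hz
      by_contra hzK
      exact lt_asymm hz (hlast v hv z hzK)
    exact hK (hup x hpx) (hup y hpy) hxy
  · exact hpos v hv x (by simp [hpx]) y (by simp [hpy]) hx hy hxy

/-- On a cycle, the two neighbours of the earliest vertex are adjacent. -/
theorem IsPerfectElimination.isChordalGraph {V : Type*} {H : SimpleGraph V} {pos : V → ℕ}
    (h : IsPerfectElimination H pos) : IsChordalGraph H := by
  classical
  intro v c hc hlen
  obtain ⟨m, hm, hmin⟩ := Finset.exists_min_image c.support.toFinset pos ⟨v, by simp⟩
  rw [List.mem_toFinset] at hm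
  set d := c.rotate m hm with hd
  have hdc : d.IsCycle := by simpa [hd] using hc
  have hdl : d.length = c.length := by simp [hd]
  have hsupp : ∀ z, z ∈ d.support ↔ z ∈ c.support := fun z => by
    simp [hd, Walk.mem_support_rotate_iff]
  have hedge : ∀ e, e ∈ d.edges ↔ e ∈ c.edges := fun e => (c.rotate_edges m hm).mem_iff
  have hnil : ¬ d.Nil := by
    rw [Walk.not_nil_iff_lt_length]; omega
  have h1 : H.Adj m d.snd := d.adj_snd hnil
  have h2 : H.Adj m d.penultimate := (d.adj_penultimate hnil).symm
  have s1 : d.snd ∈ c.support := (hsupp _).1 (d.getVert_mem_support 1)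
  have s2 : d.penultimate ∈ c.support := (hsupp _).1 (d.getVert_mem_support _)
  have hlt : ∀ z ∈ c.support, H.Adj m z → pos m < pos z := fun z hz hmz =>
    lt_of_le_of_ne (hmin z (by simpa using hz)) fun e => hmz.ne (h.1 e)
  refine ⟨d.snd, s1, d.penultimate, s2,
    h.2 m _ _ h1 h2 (hlt _ s1 h1) (hlt _ s2 h2) hdc.snd_ne_penultimate, ?_⟩
  rw [← hedge, Walk.mk_mem_edges_iff_exists]
  rintro ⟨i, hi, he⟩
  have inj := hdc.getVert_injOn
  have hpen : d.penultimate = d.getVert (d.length - 1) := rfl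
  have hsnd : d.snd = d.getVert 1 := rfl
  rw [hpen, hsnd, Sym2.eq_iff] at he
  have key : ∀ j k : ℕ, 1 ≤ j → j ≤ d.length → 1 ≤ k → k ≤ d.length →
      d.getVert j = d.getVert k → j = k := fun j k h1 h2 h3 h4 e => inj ⟨h1, h2⟩ ⟨h3, h4⟩ e
  rcases Nat.eq_zero_or_pos i with rfl | hi0
  · rw [Walk.getVert_zero] at he
    rcases he with ⟨e, -⟩ | ⟨e, -⟩
    · exact h1.ne e
    · exact h2.ne e
  · rcases he with ⟨e1, e2⟩ | ⟨e1, e2⟩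
    · have := key _ _ hi0 hi.le (by omega) (by omega) e1
      have := key _ _ (by omega) (by omega) (by omega) (by omega) e2
      omega
    · have := key _ _ (by omega) (by omega) (by omega) (by omega) e2
      omega

/-! ### Treewidth and perfect elimination orders -/

/-- A finite graph is connected if from every vertex other than `r` one can move to a neighbour with
a larger value of `f`: all these ascents end at `r`. -/
theorem connected_of_exists_adj_lt {N : Type*} [Finite N] {T : SimpleGraph N} (r : N) (f : N → ℕ)
    (h : ∀ a, a ≠ r → ∃ b, T.Adj a b ∧ f a < f b) : T.Connected := by
  obtain ⟨M, hM⟩ : ∃ M, ∀ a, f a ≤ M := by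
    obtain ⟨M, hM⟩ := (Set.finite_range f).bddAbove
    exact ⟨M, fun a => hM ⟨a, rfl⟩⟩
  have key : ∀ n : ℕ, ∀ a, M - f a = n → T.Reachable a r := by
    intro n
    induction n using Nat.strong_induction_on with
    | _ n ih =>
      intro a ha
      by_cases har : a = r
      · rw [har]
      · obtain ⟨b, hab, hlt⟩ := h a har
        have := hM b
        exact hab.reachable.trans (ih (M - f b) (by omega) b rfl)
  have : Nonempty N := ⟨r⟩
  exact ⟨fun a b => (key _ a rfl).trans (key _ b rfl).symm⟩

/-- A parent map without cycles defines a tree: it is connected and has at most one edge for each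
vertex other than the root. -/
theorem isTree_fromRel_parent {N : Type*} [Fintype N] (r : N) (p : N → N) (f : N → ℕ)
    (hp : ∀ a, a ≠ r → f a < f (p a)) :
    (SimpleGraph.fromRel fun a b => a ≠ r ∧ b = p a).IsTree := by
  classical
  have hconn : (SimpleGraph.fromRel fun a b => a ≠ r ∧ b = p a).Connected := by
    refine connected_of_exists_adj_lt r f fun a ha => ⟨p a, ?_, hp a ha⟩
    rw [SimpleGraph.fromRel_adj]
    exact ⟨fun e => (hp a ha).ne (congrArg f e), Or.inl ⟨ha, rfl⟩⟩
  refine isTree_iff_connected_and_card.2 ⟨hconn, le_antisymm ?_ ?_⟩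
  · have hsub : (SimpleGraph.fromRel fun a b => a ≠ r ∧ b = p a).edgeSet ⊆
        ((Finset.univ.erase r).image fun a => s(a, p a) : Finset (Sym2 N)) := by
      intro e
      induction e with
      | _ x y =>
        rw [SimpleGraph.mem_edgeSet, SimpleGraph.fromRel_adj]
        rintro ⟨-, ⟨h1, h2⟩ | ⟨h1, h2⟩⟩
        · simpa using ⟨x, h1, Or.inl ⟨rfl, h2.symm⟩⟩
        · simpa using ⟨y, h1, Or.inr ⟨rfl, h2.symm⟩⟩
    have h1 := Set.ncard_le_ncard hsub (Finset.finite_toSet _)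
    rw [Set.ncard_coe_finset] at h1
    have h2 := (Finset.card_image_le (s := Finset.univ.erase r) (f := fun a => s(a, p a)))
    rw [Finset.card_erase_of_mem (Finset.mem_univ r), Finset.card_univ] at h2
    have h3 : 0 < Fintype.card N := Fintype.card_pos_iff.2 ⟨r⟩
    rw [Nat.card_coe_set_eq, Nat.card_eq_fintype_card]
    omega
  · exact hconn.card_vert_le_card_edgeSet_add_one

theorem treewidth_le {V : Type*} {G : SimpleGraph V} {k : ℕ} (D : TreeDecomposition G)
    (h : ∀ t, (D.bag t).card ≤ k + 1) : treewidth G ≤ k :=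
  Nat.sInf_le ⟨D, h⟩

/-- The tree has one node per vertex `v`, with the bag of `v` and its later neighbours; the parent
of a node is the first of these later neighbours. -/
theorem IsPerfectElimination.treewidth_le {V : Type*} [Fintype V] [Nonempty V]
    {H : SimpleGraph V} {pos : V → ℕ} (h : IsPerfectElimination H pos) {k : ℕ}
    (hk : ∀ v, (laterNeighbors H pos v).card ≤ k) : treewidth H ≤ k := by
  classical
  obtain ⟨r, -, hr⟩ := Finset.exists_max_image Finset.univ pos Finset.univ_nonempty
  have hpar : ∀ v : V, ∃ w : V, (v ≠ r → pos v < pos w) ∧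
      ((laterNeighbors H pos v).Nonempty →
        w ∈ laterNeighbors H pos v ∧ ∀ z ∈ laterNeighbors H pos v, pos w ≤ pos z) := by
    intro v
    by_cases hne : (laterNeighbors H pos v).Nonempty
    · obtain ⟨w, hw, hmin⟩ := Finset.exists_min_image _ pos hne
      exact ⟨w, fun _ => (mem_laterNeighbors.1 hw).2, fun _ => ⟨hw, hmin⟩⟩
    · exact ⟨r, fun hv => lt_of_le_of_ne (hr v (Finset.mem_univ v)) fun e => hv (h.1 e),
        fun h => (hne h).elim⟩
  choose p hp1 hp2 using hpar
  have hT := isTree_fromRel_parent r p pos hp1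
  set T : SimpleGraph V := SimpleGraph.fromRel fun a b => a ≠ r ∧ b = p a with hTdef
  set e := Fintype.equivFin V
  have hbag : ∀ v w, w ∈ insert v (laterNeighbors H pos v) ↔ w = v ∨ (H.Adj v w ∧ pos v < pos w) :=
    fun v w => by rw [Finset.mem_insert, mem_laterNeighbors]
  let D : TreeDecomposition H :=
    { n := Fintype.card V
      tree := T.comap e.symm
      isTree := (Iso.isTree_iff (Iso.comap e.symm T)).2 hT
      bag := fun t => insert (e.symm t) (laterNeighbors H pos (e.symm t))
      edge_mem := by
        intro u v huv
        rcases lt_or_gt_of_ne (fun e => huv.ne (h.1 e) : pos u ≠ pos v) with hlt | hlt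
        · exact ⟨e u, by simp, by simp [mem_laterNeighbors, huv, hlt]⟩
        · exact ⟨e v, by simp [mem_laterNeighbors, huv.symm, hlt], by simp⟩
      connected := by
        intro v
        refine connected_of_exists_adj_lt ⟨e v, by simp⟩ (fun t => pos (e.symm t.1)) ?_
        rintro ⟨t, ht⟩ hne
        obtain ⟨a, rfl⟩ := e.surjective t
        have hav : v ≠ a := by
          rintro rfl
          exact hne rfl
        simp only [Set.mem_ofPred_eq, Equiv.symm_apply_apply] at ht
        have hv := (Finset.mem_insert.1 ht).resolve_left hav
        obtain ⟨hpa, hmin⟩ := hp2 a ⟨v, hv⟩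
        obtain ⟨hadj, hlt⟩ := mem_laterNeighbors.1 hpa
        obtain ⟨hadj', hlt'⟩ := mem_laterNeighbors.1 hv
        have har : a ≠ r := by
          rintro rfl
          exact (hr v (Finset.mem_univ v)).not_gt hlt'
        refine ⟨⟨e (p a), ?_⟩, ?_, ?_⟩
        · simp only [Set.mem_ofPred_eq, Equiv.symm_apply_apply]
          rw [hbag]
          by_cases hvp : v = p a
          · exact Or.inl hvp
          · exact Or.inr ⟨h.2 a _ _ hadj hadj' hlt hlt' (Ne.symm hvp),
              lt_of_le_of_ne (hmin v hv) fun e => hvp (h.1 e).symm⟩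
        · simp only [SimpleGraph.comap_adj, Function.Embedding.subtype_apply,
            Equiv.symm_apply_apply, hTdef, SimpleGraph.fromRel_adj]
          exact ⟨hadj.ne, Or.inl ⟨har, trivial⟩⟩
        · simpa using hlt }
  exact SimpleGraph.treewidth_le D fun t =>
    (Finset.card_insert_le _ _).trans (Nat.succ_le_succ (hk _))

theorem exists_treeDecomposition_card_bag_le {V : Type*} [Fintype V] (G : SimpleGraph V) :
    ∃ k : ℕ, ∃ D : TreeDecomposition G, ∀ t, (D.bag t).card ≤ k + 1 := by
  refine ⟨Fintype.card V, ⟨1, ⊥, IsTree.of_subsingleton, fun _ => Finset.univ,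
    fun _ _ _ => ⟨0, by simp, by simp⟩, fun v => ?_⟩, fun _ => ?_⟩
  · have : Nonempty {t : Fin 1 | v ∈ (Finset.univ : Finset V)} := ⟨⟨0, by simp⟩⟩
    exact ⟨Preconnected.of_subsingleton⟩
  · exact (Finset.card_univ (α := V)).le.trans (Nat.le_succ _)

theorem exists_treeDecomposition_card_bag_le_treewidth {V : Type*} [Fintype V]
    (G : SimpleGraph V) :
    ∃ D : TreeDecomposition G, ∀ t, (D.bag t).card ≤ treewidth G + 1 :=
  Nat.sInf_mem (exists_treeDecomposition_card_bag_le G)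

theorem treewidth_mono {V : Type*} [Fintype V] {G H : SimpleGraph V} (h : G ≤ H) :
    treewidth G ≤ treewidth H := by
  obtain ⟨D, hD⟩ := exists_treeDecomposition_card_bag_le_treewidth H
  exact treewidth_le ⟨D.n, D.tree, D.isTree, D.bag, fun u v huv => D.edge_mem u v (h huv),
    D.connected⟩ hD

/-- Two meeting subtrees `A` and `B` of a tree rooted at `r`: the one whose top is the higher
contains the top of the other. -/
theorem IsTree.mem_of_dist_le {N : Type*} {T : SimpleGraph N} (hT : T.IsTree) (r : N)
    {A B : Set N} (hA : (T.induce A).Connected) (hB : (T.induce B).Connected) {a b t : N}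
    (ha : a ∈ A) (hb : b ∈ B) (hamin : ∀ x ∈ A, T.dist r a ≤ T.dist r x)
    (hba : T.dist r b ≤ T.dist r a) (htA : t ∈ A) (htB : t ∈ B) : a ∈ B := by
  classical
  by_contra haB
  have hab : a ≠ b := fun e => haB (e ▸ hb)
  have hconn := hT.connected
  by_cases har : a = r
  · subst har
    rw [dist_self, Nat.le_zero, hconn.dist_eq_zero_iff] at hba
    exact hab hba
  -- Deleting the edge from `a` to its parent `c` separates `A` from `r`.
  obtain ⟨c, hca, hlt⟩ : ∃ c, T.Adj c a ∧ T.dist r c < T.dist r a := by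
    obtain ⟨q, hq⟩ := hconn.exists_walk_length_eq_dist r a
    have hnil : ¬ q.Nil := fun h => har h.eq.symm
    refine ⟨q.penultimate, q.adj_penultimate hnil, ?_⟩
    have := dist_le q.dropLast
    have h2 : q.dropLast.length + 1 = q.length := q.length_dropLast_add_one hnil
    omega
  have hcA : c ∉ A := fun h => (hamin c h).not_gt hlt
  have hbridge : ¬ (T.deleteEdges {s(c, a)}).Reachable c a :=
    (isBridge_iff.1 (isAcyclic_iff_forall_adj_isBridge.1 hT.isAcyclic hca))
  have hind : ∀ S : Set N, (T.induce S).Connected → (c ∉ S ∨ a ∉ S) → ∀ x ∈ S, ∀ y ∈ S,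
      (T.deleteEdges {s(c, a)}).Reachable x y := by
    intro S hS hca x hx y hy
    let φ : T.induce S →g T.deleteEdges {s(c, a)} :=
      { toFun := fun z => z.1
        map_rel' := by
          rintro ⟨z, hz⟩ ⟨w, hw⟩ hzw
          rw [SimpleGraph.deleteEdges_adj]
          refine ⟨hzw, fun he => ?_⟩
          rw [Set.mem_singleton_iff, Sym2.eq_iff] at he
          rcases he with ⟨h1, h2⟩ | ⟨h1, h2⟩ <;> simp only at h1 h2 <;> subst h1 <;> subst h2
          · exact hca.elim (fun h => h hz) (fun h => h hw)
          · exact hca.elim (fun h => h hw) (fun h => h hz) }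
    exact (hS.preconnected ⟨x, hx⟩ ⟨y, hy⟩).map φ
  have hgeo : ∀ x, x ≠ a → T.dist r x ≤ T.dist r a →
      (T.deleteEdges {s(c, a)}).Reachable r x := by
    intro x hxa hx
    obtain ⟨q, hq⟩ := hconn.exists_walk_length_eq_dist r x
    refine reachable_deleteEdges_iff_exists_walk.2 ⟨q, fun he => ?_⟩
    have hmem : a ∈ q.support := q.snd_mem_support_of_mem_edges he
    have h1 := Walk.length_takeUntil_lt_length hmem hxa.symm
    have h2 := dist_le (q.takeUntil a hmem)
    omega
  exact hbridge ((hgeo c hca.ne hlt.le).symm.trans ((hgeo b hab.symm hba).trans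
    ((hind B hB (Or.inr haB) b hb t htB).trans (hind A hA (Or.inl hcA) t htA a ha))))

/-- Eliminating first the vertices whose subtrees have the lowest tops, one never sees more than a
bag of later neighbours. -/
theorem TreeDecomposition.exists_isPerfectElimination {V : Type*} [Fintype V] {G : SimpleGraph V}
    {k : ℕ} (D : TreeDecomposition G) (hD : ∀ t, (D.bag t).card ≤ k + 1) :
    ∃ H : SimpleGraph V, G ≤ H ∧ ∃ pos : V → ℕ, IsPerfectElimination H pos ∧
      ∀ v, (laterNeighbors H pos v).card ≤ k := by
  classical
  obtain ⟨r⟩ := D.isTree.connected.nonempty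
  have htop : ∀ v, ∃ a, v ∈ D.bag a ∧ ∀ t, v ∈ D.bag t → D.tree.dist r a ≤ D.tree.dist r t := by
    intro v
    obtain ⟨t, ht⟩ := (D.connected v).nonempty
    obtain ⟨a, ha, hmin⟩ := Finset.exists_min_image (Finset.univ.filter fun t => v ∈ D.bag t)
      (D.tree.dist r) ⟨t, by simpa using ht⟩
    exact ⟨a, by simpa using ha, fun t ht => hmin t (by simpa using ht)⟩
  choose top htop1 htop2 using htop
  obtain ⟨pos, hinj, -, hpos⟩ := exists_elimination_order (∅ : Finset V)
    (fun v W => ∀ w ∈ W, (∃ t, v ∈ D.bag t ∧ w ∈ D.bag t) → w ∈ D.bag (top v)) (by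
      intro W hW
      obtain ⟨v, hv, hmax⟩ := Finset.exists_max_image W (fun v => D.tree.dist r (top v))
        (Finset.empty_ssubset.1 hW)
      refine ⟨v, hv, by simp, fun w hw => ?_⟩
      rintro ⟨t, htv, htw⟩
      exact D.isTree.mem_of_dist_le r (D.connected v) (D.connected w) (htop1 v) (htop1 w)
        (htop2 v) (hmax w (Finset.mem_of_mem_erase hw)) htv htw)
  let H : SimpleGraph V := SimpleGraph.fromRel fun x y => ∃ t, x ∈ D.bag t ∧ y ∈ D.bag t
  have hH : ∀ x y, H.Adj x y ↔ x ≠ y ∧ ∃ t, x ∈ D.bag t ∧ y ∈ D.bag t := by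
    intro x y
    rw [SimpleGraph.fromRel_adj]
    refine and_congr_right fun _ => ⟨?_, Or.inl⟩
    rintro (h | ⟨t, h1, h2⟩)
    · exact h
    · exact ⟨t, h2, h1⟩
  have hbag : ∀ v w, w ∈ laterNeighbors H pos v → w ∈ D.bag (top v) := by
    intro v w hw
    obtain ⟨hadj, hlt⟩ := mem_laterNeighbors.1 hw
    exact hpos v (by simp) w (by simpa using hlt) ((hH v w).1 hadj).2
  refine ⟨H, fun x y hxy => (hH x y).2 ⟨hxy.ne, D.edge_mem x y hxy⟩, pos,
    ⟨hinj, fun v x y hx hy hpx hpy hxy => (hH x y).2 ⟨hxy, top v,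
      hbag v x (mem_laterNeighbors.2 ⟨hx, hpx⟩), hbag v y (mem_laterNeighbors.2 ⟨hy, hpy⟩)⟩⟩,
    fun v => ?_⟩
  have hsub : laterNeighbors H pos v ⊆ (D.bag (top v)).erase v := fun w hw =>
    Finset.mem_erase.2 ⟨(mem_laterNeighbors.1 hw).1.ne', hbag v w hw⟩
  have h1 := Finset.card_le_card hsub
  rw [Finset.card_erase_of_mem (htop1 v)] at h1
  have := hD (top v)
  omega

/-- Every edge is counted at its earlier end. -/
theorem numEdges_eq_sum_card_laterNeighbors {V : Type*} [Fintype V] (H : SimpleGraph V)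
    {pos : V → ℕ} (hpos : Function.Injective pos) :
    numEdges H = ∑ v, (laterNeighbors H pos v).card := by
  classical
  rw [← Finset.card_sigma, numEdges, ← Set.ncard_coe_finset]
  symm
  refine Set.ncard_congr (fun a _ => s(a.1, a.2)) ?_ ?_ ?_
  · rintro ⟨v, w⟩ h
    simp only [Finset.coe_sigma, Finset.coe_univ, Set.mem_sigma_iff, Finset.mem_coe,
      mem_laterNeighbors] at h
    exact h.2.1
  · rintro ⟨v, w⟩ ⟨v', w'⟩ h h' he
    simp only [Finset.coe_sigma, Finset.coe_univ, Set.mem_sigma_iff, Finset.mem_coe,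
      mem_laterNeighbors] at h h'
    rw [Sym2.eq_iff] at he
    rcases he with ⟨h1, h2⟩ | ⟨h1, h2⟩ <;> simp only at h1 h2 <;> subst h1 <;> subst h2
    · rfl
    · exact (lt_asymm h.2.2 h'.2.2).elim
  · intro e he
    induction e with
    | _ x y =>
      have hxy : H.Adj x y := he
      rcases lt_or_gt_of_ne (fun e => hxy.ne (hpos e) : pos x ≠ pos y) with hlt | hlt
      · exact ⟨⟨x, y⟩, by simp [mem_laterNeighbors, hxy, hlt], rfl⟩
      · exact ⟨⟨y, x⟩, by simp [mem_laterNeighbors, hxy.symm, hlt], Sym2.eq_swap⟩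

/-- In a perfect elimination order, a vertex and its later neighbours form a clique, so without a
clique of `k + 2` vertices the order bounds the treewidth by `k`. -/
theorem IsChordalGraph.exists_clique_of_lt_treewidth {V : Type*} [Fintype V] [Nonempty V]
    {H : SimpleGraph V} (hH : IsChordalGraph H) {k : ℕ} (hk : k < treewidth H) :
    ∃ K : Finset V, K.card = k + 2 ∧ H.IsClique (K : Set V) := by
  classical
  obtain ⟨pos, hpos, -⟩ := hH.exists_isPerfectElimination ∅ (by simp)
  by_contra hno
  refine hk.not_ge (hpos.treewidth_le fun v => ?_)
  by_contra hv
  push Not at hv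
  obtain ⟨L, hL, hLc⟩ := Finset.exists_subset_card_eq (Nat.succ_le_of_lt hv)
  have hLn : ∀ w ∈ L, H.Adj v w ∧ pos v < pos w := fun w hw => mem_laterNeighbors.1 (hL hw)
  refine hno ⟨insert v L, ?_, ?_⟩
  · rw [Finset.card_insert_of_notMem fun h => (hLn v h).1.ne rfl, hLc]
  · rw [Finset.coe_insert, SimpleGraph.isClique_insert]
    refine ⟨fun x hx y hy hxy => hpos.2 v x y (hLn x hx).1 (hLn y hy).1 (hLn x hx).2
      (hLn y hy).2 hxy, fun w hw _ => (hLn w hw).1⟩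

/-! ### Elimination orders of rook's graphs -/

theorem rookGraph_adj {m n : ℕ} {x y : Fin m × Fin n} :
    (rookGraph m n).Adj x y ↔ x ≠ y ∧ (x.1 = y.1 ∨ x.2 = y.2) := by
  rw [rookGraph, boxProd_adj, completeGraph_eq_top, completeGraph_eq_top, top_adj, top_adj]
  simp only [ne_eq, Prod.ext_iff]
  tauto

/-- Two lines (rows or columns) are linked by the cells of `S` if one can pass from one to the
other through cells of `S`, each of which joins its row to its column. -/
def LinesLinked {m n : ℕ} (S : Set (Fin m × Fin n)) : Fin m ⊕ Fin n → Fin m ⊕ Fin n → Prop :=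
  Relation.EqvGen fun a b => ∃ x ∈ S, a = Sum.inl x.1 ∧ b = Sum.inr x.2

namespace LinesLinked

variable {m n : ℕ} {S T : Set (Fin m × Fin n)} {a b c : Fin m ⊕ Fin n}

theorem refl (a : Fin m ⊕ Fin n) : LinesLinked S a a := Relation.EqvGen.refl a

theorem symm (h : LinesLinked S a b) : LinesLinked S b a := Relation.EqvGen.symm _ _ h

theorem trans (h : LinesLinked S a b) (h' : LinesLinked S b c) : LinesLinked S a c :=
  Relation.EqvGen.trans _ _ _ h h'

theorem of_mem {x : Fin m × Fin n} (hx : x ∈ S) : LinesLinked S (Sum.inl x.1) (Sum.inr x.2) :=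
  Relation.EqvGen.rel _ _ ⟨x, hx, rfl, rfl⟩

theorem mono (hST : S ⊆ T) (h : LinesLinked S a b) : LinesLinked T a b :=
  Relation.EqvGen.mono (fun _ _ ⟨x, hx, h⟩ => ⟨x, hST hx, h⟩) _ _ h

theorem eq_of_empty (h : LinesLinked (∅ : Set (Fin m × Fin n)) a b) : a = b := by
  induction h with
  | rel _ _ h => obtain ⟨x, hx, -⟩ := h; exact hx.elim
  | refl => rfl
  | symm _ _ _ ih => exact ih.symm
  | trans _ _ _ _ _ ih1 ih2 => exact ih1.trans ih2

theorem of_insert {v : Fin m × Fin n} (h : LinesLinked (insert v S) a b) :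
    LinesLinked S a b ∨
      ((LinesLinked S a (Sum.inl v.1) ∨ LinesLinked S a (Sum.inr v.2)) ∧
        (LinesLinked S b (Sum.inl v.1) ∨ LinesLinked S b (Sum.inr v.2))) := by
  induction h with
  | rel a b h =>
    obtain ⟨x, hx, rfl, rfl⟩ := h
    rcases hx with rfl | hx
    · exact Or.inr ⟨Or.inl (refl _), Or.inr (refl _)⟩
    · exact Or.inl (of_mem hx)
  | refl => exact Or.inl (refl _)
  | symm a b _ ih => exact ih.imp symm And.symm
  | trans a b c _ _ ih1 ih2 =>
    rcases ih1 with h1 | ⟨h1, h1'⟩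
    · rcases ih2 with h2 | ⟨h2, h2'⟩
      · exact Or.inl (h1.trans h2)
      · exact Or.inr ⟨h2.imp h1.trans h1.trans, h2'⟩
    · rcases ih2 with h2 | ⟨h2, h2'⟩
      · exact Or.inr ⟨h1, h1'.imp h2.symm.trans h2.symm.trans⟩
      · exact Or.inr ⟨h1, h2'⟩

theorem of_insert_left {v : Fin m × Fin n} (h : LinesLinked (insert v S) a (Sum.inl v.1)) :
    LinesLinked S a (Sum.inl v.1) ∨ LinesLinked S a (Sum.inr v.2) := by
  rcases h.of_insert with h | ⟨h, -⟩
  · exact Or.inl h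
  · exact h

end LinesLinked

theorem setOf_pos_lt_succ {V : Type*} {pos : V → ℕ} (hpos : Function.Injective pos) (v : V) :
    {w | pos w < pos v + 1} = insert v {w | pos w < pos v} := by
  ext w
  simp only [Set.mem_ofPred_eq, Set.mem_insert_iff, Nat.lt_succ_iff_lt_or_eq, hpos.eq_iff]
  exact or_comm

/-- Two cells that are still present lie on linked lines only if they have become adjacent: a cell
being eliminated is a neighbour of all the cells on the lines it links. -/
theorem IsPerfectElimination.adj_of_linesLinked {m n : ℕ} {H : SimpleGraph (Fin m × Fin n)}
    {pos : Fin m × Fin n → ℕ} (hH : rookGraph m n ≤ H) (hpos : IsPerfectElimination H pos)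
    (N : ℕ) : ∀ {a b : Fin m ⊕ Fin n} {x y : Fin m × Fin n},
      LinesLinked {w | pos w < N} a b → (a = Sum.inl x.1 ∨ a = Sum.inr x.2) →
      (b = Sum.inl y.1 ∨ b = Sum.inr y.2) → N ≤ pos x → N ≤ pos y → x ≠ y → H.Adj x y := by
  induction N with
  | zero =>
    intro a b x y hab hx hy _ _ hxy
    have h0 : {w | pos w < 0} = (∅ : Set (Fin m × Fin n)) := by simp
    rw [h0] at hab
    obtain rfl := hab.eq_of_empty
    refine hH (rookGraph_adj.2 ⟨hxy, ?_⟩)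
    rcases hx with rfl | rfl <;> rcases hy with hy | hy
    · exact Or.inl (Sum.inl.inj hy)
    · exact absurd hy (by simp)
    · exact absurd hy (by simp)
    · exact Or.inr (Sum.inr.inj hy)
  | succ N ih =>
    intro a b x y hab hx hy hNx hNy hxy
    by_cases hv : ∃ v, pos v = N
    · obtain ⟨v, rfl⟩ := hv
      rw [setOf_pos_lt_succ hpos.1] at hab
      have hvadj : ∀ (z : Fin m × Fin n) (c : Fin m ⊕ Fin n), pos v + 1 ≤ pos z →
          (c = Sum.inl z.1 ∨ c = Sum.inr z.2) →
          (LinesLinked {w | pos w < pos v} c (Sum.inl v.1) ∨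
            LinesLinked {w | pos w < pos v} c (Sum.inr v.2)) → H.Adj v z := by
        intro z c hz hcz hc
        have hne : z ≠ v := by
          rintro rfl
          omega
        rcases hc with hc | hc
        · exact (ih hc hcz (Or.inl rfl) (by omega) le_rfl hne).symm
        · exact (ih hc hcz (Or.inr rfl) (by omega) le_rfl hne).symm
      rcases hab.of_insert with h | ⟨h1, h2⟩
      · exact ih h hx hy (by omega) (by omega) hxy
      · exact hpos.2 v x y (hvadj x a hNx hx h1) (hvadj y b hNy hy h2) hNx hNy hxy
    · have hS : {w | pos w < N + 1} = {w | pos w < N} := by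
        ext w
        have : pos w ≠ N := fun h => hv ⟨w, h⟩
        simp only [Set.mem_ofPred_eq]
        omega
      rw [hS] at hab
      exact ih hab hx hy (by omega) (by omega) hxy

section Lines

variable {m n : ℕ} (pos : Fin m × Fin n → ℕ) (v : Fin m × Fin n)

open Classical in
/-- The rows that are linked to `v` by the cells up to and including `v`. -/
noncomputable def linkedRows : Finset (Fin m) :=
  Finset.univ.filter fun i => LinesLinked {w | pos w < pos v + 1} (Sum.inl i) (Sum.inl v.1)

open Classical in
/-- The columns that are linked to `v` by the cells up to and including `v`. -/
noncomputable def linkedCols : Finset (Fin n) :=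
  Finset.univ.filter fun j => LinesLinked {w | pos w < pos v + 1} (Sum.inr j) (Sum.inl v.1)

open Classical in
/-- The cells up to and including `v` in the linked rows and columns of `v`: the component of `v`
in the rook's graph induced on the cells up to and including `v`. -/
noncomputable def linkedCells : Finset (Fin m × Fin n) :=
  Finset.univ.filter fun x => pos x ≤ pos v ∧ x.1 ∈ linkedRows pos v ∧ x.2 ∈ linkedCols pos v

variable {pos v}

theorem mem_linkedRows {i : Fin m} : i ∈ linkedRows pos v ↔
    LinesLinked {w | pos w < pos v + 1} (Sum.inl i) (Sum.inl v.1) := by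
  simp [linkedRows]

theorem mem_linkedCols {j : Fin n} : j ∈ linkedCols pos v ↔
    LinesLinked {w | pos w < pos v + 1} (Sum.inr j) (Sum.inl v.1) := by
  simp [linkedCols]

theorem mem_linkedCells {x : Fin m × Fin n} : x ∈ linkedCells pos v ↔
    pos x ≤ pos v ∧ x.1 ∈ linkedRows pos v ∧ x.2 ∈ linkedCols pos v := by
  simp [linkedCells]

theorem mem_linkedRows_iff_mem_linkedCols {x : Fin m × Fin n} (hx : pos x ≤ pos v) :
    x.1 ∈ linkedRows pos v ↔ x.2 ∈ linkedCols pos v := by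
  rw [mem_linkedRows, mem_linkedCols]
  have h : LinesLinked {w | pos w < pos v + 1} (Sum.inl x.1) (Sum.inr x.2) :=
    LinesLinked.of_mem (Nat.lt_succ_of_le hx)
  exact ⟨h.symm.trans, h.trans⟩

theorem fst_mem_linkedRows : v.1 ∈ linkedRows pos v := mem_linkedRows.2 (LinesLinked.refl _)

theorem snd_mem_linkedCols : v.2 ∈ linkedCols pos v :=
  (mem_linkedRows_iff_mem_linkedCols le_rfl).1 fst_mem_linkedRows

theorem card_linkedCells_le : (linkedCells pos v).card ≤
    (linkedRows pos v).card * (linkedCols pos v).card := by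
  rw [← Finset.card_product]
  exact Finset.card_le_card fun x hx => Finset.mem_product.2 (mem_linkedCells.1 hx).2

theorem two_le_card_linkedCols {u : Fin m × Fin n} (hu : pos u < pos v) (h : u.1 = v.1) :
    2 ≤ (linkedCols pos v).card := by
  refine Finset.one_lt_card.2 ⟨u.2, ?_, v.2, snd_mem_linkedCols, fun h2 => ?_⟩
  · exact (mem_linkedRows_iff_mem_linkedCols hu.le).1 (h ▸ fst_mem_linkedRows)
  · exact hu.ne (congrArg pos (Prod.ext h h2))

theorem two_le_card_linkedRows {u : Fin m × Fin n} (hu : pos u < pos v) (h : u.2 = v.2) :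
    2 ≤ (linkedRows pos v).card := by
  refine Finset.one_lt_card.2 ⟨u.1, ?_, v.1, fst_mem_linkedRows, fun h2 => ?_⟩
  · exact (mem_linkedRows_iff_mem_linkedCols hu.le).2 (h ▸ snd_mem_linkedCols)
  · exact hu.ne (congrArg pos (Prod.ext h2 h))

/-- With `r` linked rows, `q` linked columns and `c` linked cells, the vertex `v` has at least
`n r + m q - r q - c` later neighbours: the cells of these lines that are still present. -/
theorem IsPerfectElimination.le_card_laterNeighbors {H : SimpleGraph (Fin m × Fin n)}
    (hH : rookGraph m n ≤ H) (hpos : IsPerfectElimination H pos) (v : Fin m × Fin n) :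
    n * (linkedRows pos v).card + m * (linkedCols pos v).card ≤
      (linkedRows pos v).card * (linkedCols pos v).card + (linkedCells pos v).card +
        (laterNeighbors H pos v).card := by
  classical
  set R := linkedRows pos v
  set Q := linkedCols pos v
  have h1 := Finset.card_union_add_card_inter (R ×ˢ (Finset.univ : Finset (Fin n)))
    ((Finset.univ : Finset (Fin m)) ×ˢ Q)
  have h2 : (R ×ˢ (Finset.univ : Finset (Fin n))) ∩ ((Finset.univ : Finset (Fin m)) ×ˢ Q)
      = R ×ˢ Q := by
    ext x
    simp
  rw [h2, Finset.card_product, Finset.card_product, Finset.card_product, Finset.card_univ,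
    Finset.card_univ, Fintype.card_fin, Fintype.card_fin] at h1
  have h3 : (R ×ˢ (Finset.univ : Finset (Fin n))) ∪ ((Finset.univ : Finset (Fin m)) ×ˢ Q) ⊆
      linkedCells pos v ∪ laterNeighbors H pos v := by
    intro x hx
    have hx' : x.1 ∈ R ∨ x.2 ∈ Q := by simpa using hx
    rw [Finset.mem_union]
    rcases le_or_gt (pos x) (pos v) with hle | hlt
    · have := mem_linkedRows_iff_mem_linkedCols hle
      exact Or.inl (mem_linkedCells.2 ⟨hle, by tauto, by tauto⟩)
    · right
      have hne : x ≠ v := by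
        rintro rfl
        exact lt_irrefl _ hlt
      have key : ∀ a, (a = Sum.inl x.1 ∨ a = Sum.inr x.2) →
          LinesLinked {w | pos w < pos v + 1} a (Sum.inl v.1) →
          x ∈ laterNeighbors H pos v := by
        intro a ha h
        rw [setOf_pos_lt_succ hpos.1] at h
        refine mem_laterNeighbors.2 ⟨?_, hlt⟩
        rcases h.of_insert_left with h | h
        · exact (hpos.adj_of_linesLinked hH _ h ha (Or.inl rfl) hlt.le le_rfl hne).symm
        · exact (hpos.adj_of_linesLinked hH _ h ha (Or.inr rfl) hlt.le le_rfl hne).symm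
      rcases hx' with hx' | hx'
      · exact key _ (Or.inl rfl) (mem_linkedRows.1 hx')
      · exact key _ (Or.inr rfl) (mem_linkedCols.1 hx')
  have h4 := (Finset.card_le_card h3).trans (Finset.card_union_le _ _)
  have h5 := Nat.mul_comm (R.card) n
  omega

end Lines

/-! ### Lower bounds for the `4 × 5` rook's graph -/

/-- Consider the first step that links at least four lines. Before it, linked lines come in classes
of at most three, so that it links `r` rows and `q` columns by at most `r + q - 1` cells. -/
theorem IsPerfectElimination.exists_eleven_le_card_laterNeighbors
    {H : SimpleGraph (Fin 4 × Fin 5)} {pos : Fin 4 × Fin 5 → ℕ} (hH : rookGraph 4 5 ≤ H)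
    (hpos : IsPerfectElimination H pos) : ∃ v, 11 ≤ (laterNeighbors H pos v).card := by
  classical
  let cls : ℕ → Fin 4 ⊕ Fin 5 → Finset (Fin 4 ⊕ Fin 5) :=
    fun N a => Finset.univ.filter fun b => LinesLinked {w | pos w < N} b a
  have mem_cls : ∀ N a b, b ∈ cls N a ↔ LinesLinked {w | pos w < N} b a := by
    intro N a b
    simp [cls]
  have hex : ∃ N, ∃ a, 4 ≤ (cls N a).card := by
    obtain ⟨M, hM⟩ := (Set.finite_range pos).bddAbove
    have hall : ∀ x, x ∈ {w | pos w < M + 1} := fun x => Nat.lt_succ_of_le (hM ⟨x, rfl⟩)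
    refine ⟨M + 1, Sum.inl 0, ?_⟩
    have huniv : cls (M + 1) (Sum.inl 0) = Finset.univ := by
      refine Finset.eq_univ_iff_forall.2 fun b => (mem_cls _ _ _).2 ?_
      have hcol : ∀ j : Fin 5, LinesLinked {w | pos w < M + 1} (Sum.inr j : Fin 4 ⊕ Fin 5)
          (Sum.inl 0) := fun j => (LinesLinked.of_mem (hall (0, j))).symm
      rcases b with i | j
      · exact (LinesLinked.of_mem (hall (i, 0))).trans (hcol 0)
      · exact hcol j
    rw [huniv]
    decide
  obtain ⟨N, hN, hmin⟩ : ∃ N, (∃ a, 4 ≤ (cls N a).card) ∧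
      ∀ N' < N, ∀ a, (cls N' a).card ≤ 3 := by
    refine ⟨Nat.find hex, Nat.find_spec hex, fun N' hN' a => ?_⟩
    have := Nat.find_min hex hN'
    push Not at this
    exact Nat.le_of_lt_succ (this a)
  obtain ⟨a, ha⟩ := hN
  obtain _ | N := N
  · exfalso
    have : cls 0 a ⊆ {a} := by
      intro b hb
      rw [mem_cls] at hb
      have h0 : {w | pos w < 0} = (∅ : Set (Fin 4 × Fin 5)) := by simp
      rw [h0] at hb
      exact Finset.mem_singleton.2 hb.eq_of_empty
    have := Finset.card_le_card this
    rw [Finset.card_singleton] at this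
    omega
  specialize hmin N (Nat.lt_succ_self N)
  by_cases hv : ∃ v, pos v = N
  swap
  · exfalso
    have hS : {w | pos w < N + 1} = {w | pos w < N} := by
      ext w
      have : pos w ≠ N := fun h => hv ⟨w, h⟩
      simp only [Set.mem_ofPred_eq]
      omega
    have : cls (N + 1) a = cls N a := by
      ext b
      rw [mem_cls, mem_cls, hS]
    rw [this] at ha
    have := hmin a
    omega
  obtain ⟨v, rfl⟩ := hv
  have hins := setOf_pos_lt_succ hpos.1 v
  have hvlink : LinesLinked {w | pos w < pos v + 1} (Sum.inl v.1) (Sum.inr v.2) :=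
    LinesLinked.of_mem (Nat.lt_succ_self _)
  have hsubset : {w | pos w < pos v} ⊆ {w | pos w < pos v + 1} := fun w hw =>
    Nat.lt_succ_of_lt hw
  set A := cls (pos v) (Sum.inl v.1)
  set B := cls (pos v) (Sum.inr v.2)
  have hC : ∀ b, b ∈ cls (pos v + 1) (Sum.inl v.1) ↔ b ∈ A ∨ b ∈ B := by
    intro b
    rw [mem_cls, mem_cls, mem_cls]
    constructor
    · intro h
      rw [hins] at h
      exact h.of_insert_left
    · rintro (h | h)
      · exact h.mono hsubset
      · exact (h.mono hsubset).trans hvlink.symm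
  have hav : LinesLinked {w | pos w < pos v + 1} a (Sum.inl v.1) := by
    by_contra hno
    have : cls (pos v + 1) a ⊆ cls (pos v) a := by
      intro b hb
      rw [mem_cls] at hb ⊢
      have hb' := hb
      rw [hins] at hb'
      rcases hb'.of_insert with h | ⟨-, h | h⟩
      · exact h
      · exact (hno (h.mono hsubset)).elim
      · exact (hno ((h.mono hsubset).trans hvlink.symm)).elim
    have := Finset.card_le_card this
    have := hmin a
    omega
  have hcard : 4 ≤ (cls (pos v + 1) (Sum.inl v.1)).card := by
    refine ha.trans (Finset.card_le_card fun b hb => ?_)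
    rw [mem_cls] at hb ⊢
    exact hb.trans hav
  have hAB : cls (pos v + 1) (Sum.inl v.1) = A ∪ B := by
    ext b
    rw [hC, Finset.mem_union]
  have hdisj : Disjoint A B := by
    rw [Finset.disjoint_left]
    intro b hbA hbB
    rw [mem_cls] at hbA hbB
    have hBA : B ⊆ A := by
      intro x hx
      rw [mem_cls] at hx ⊢
      exact hx.trans (hbB.symm.trans hbA)
    rw [hAB, Finset.union_eq_left.2 hBA] at hcard
    have : A.card ≤ 3 := hmin _
    omega
  have hRow : ∀ i, i ∈ linkedRows pos v ↔ Sum.inl i ∈ A ∨ Sum.inl i ∈ B := by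
    intro i
    rw [mem_linkedRows, ← mem_cls, hC]
  have hCol : ∀ j, j ∈ linkedCols pos v ↔ Sum.inr j ∈ A ∨ Sum.inr j ∈ B := by
    intro i
    rw [mem_linkedCols, ← mem_cls, hC]
  have hRL : (A ∪ B).toLeft = linkedRows pos v := by
    ext i
    simp [hRow]
  have hQR : (A ∪ B).toRight = linkedCols pos v := by
    ext i
    simp [hCol]
  have hcells : linkedCells pos v ⊆
      insert v (A.toLeft ×ˢ A.toRight ∪ B.toLeft ×ˢ B.toRight) := by
    intro x hx
    obtain ⟨hle, hr, -⟩ := mem_linkedCells.1 hx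
    rw [Finset.mem_insert]
    refine or_iff_not_imp_left.2 fun hxv => ?_
    have hlt : pos x < pos v := lt_of_le_of_ne hle fun e => hxv (hpos.1 e)
    have hlink : LinesLinked {w | pos w < pos v} (Sum.inl x.1) (Sum.inr x.2) :=
      LinesLinked.of_mem hlt
    rw [Finset.mem_union, Finset.mem_product, Finset.mem_product]
    simp only [Finset.mem_toLeft, Finset.mem_toRight]
    rcases (hRow _).1 hr with h | h
    · refine Or.inl ⟨h, ?_⟩
      rw [mem_cls] at h ⊢
      exact hlink.symm.trans h
    · refine Or.inr ⟨h, ?_⟩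
      rw [mem_cls] at h ⊢
      exact hlink.symm.trans h
  have c1 := (Finset.card_le_card hcells).trans (Finset.card_insert_le _ _)
  have c2 := Finset.card_union_le (A.toLeft ×ˢ A.toRight) (B.toLeft ×ˢ B.toRight)
  rw [Finset.card_product, Finset.card_product] at c2
  have c3 := Finset.card_union_of_disjoint hdisj
  have c4 := (A ∪ B).card_toLeft_add_card_toRight
  rw [hRL, hQR] at c4
  have c5 := A.card_toLeft_add_card_toRight
  have c6 := B.card_toLeft_add_card_toRight
  have c7 : A.card ≤ 3 := hmin _
  have c8 : B.card ≤ 3 := hmin _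
  have c9 : 0 < A.card := Finset.card_pos.2 ⟨_, (mem_cls _ _ _).2 (LinesLinked.refl _)⟩
  have c10 : 0 < B.card := Finset.card_pos.2 ⟨_, (mem_cls _ _ _).2 (LinesLinked.refl _)⟩
  have hmul : ∀ x y k : ℕ, x + y = k → k ≤ 3 → 0 < k → x * y + 1 ≤ k := by
    intro x y k h h3 h0
    have hx : x ≤ 3 := by omega
    interval_cases x <;> omega
  have c11 := hmul _ _ _ c5 c7 c9
  have c12 := hmul _ _ _ c6 c8 c10
  have c13 := hpos.le_card_laterNeighbors hH v
  have r1 : 0 < (linkedRows pos v).card := Finset.card_pos.2 ⟨_, fst_mem_linkedRows⟩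
  have q1 : 0 < (linkedCols pos v).card := Finset.card_pos.2 ⟨_, snd_mem_linkedCols⟩
  have r4 : (linkedRows pos v).card ≤ 4 := by simpa using (linkedRows pos v).card_le_univ
  rw [hAB] at hcard
  refine ⟨v, ?_⟩
  generalize (linkedRows pos v).card = r at *
  generalize (linkedCols pos v).card = q at *
  interval_cases r <;> omega

/-- Every pair of elements of `K` is counted once, at its earlier element. -/
theorem sum_card_filter_lt {V : Type*} [DecidableEq V] (K : Finset V) {pos : V → ℕ}
    (hpos : Function.Injective pos) :
    2 * ∑ v ∈ K, (K.filter fun w => pos v < pos w).card = K.card * (K.card - 1) := by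
  have h1 : ∑ v ∈ K, (K.filter fun w => pos v < pos w).card =
      ∑ v ∈ K, (K.filter fun w => pos w < pos v).card :=
    Finset.sum_card_bipartiteAbove_eq_sum_card_bipartiteBelow fun v w => pos v < pos w
  rw [two_mul]
  nth_rewrite 2 [h1]
  rw [← Finset.sum_add_distrib, ← smul_eq_mul, ← Finset.sum_const]
  refine Finset.sum_congr rfl fun v hv => ?_
  rw [← Finset.card_erase_of_mem hv, ← Finset.card_union_of_disjoint]
  · congr 1
    ext w
    have hne := hpos.ne_iff (x := w) (y := v)
    simp only [Finset.mem_union, Finset.mem_filter, Finset.mem_erase, ← hne]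
    by_cases hw : w ∈ K
    · simp only [hw, true_and, and_true]
      omega
    · simp [hw]
  · rw [Finset.disjoint_left]
    intro w h1 h2
    exact lt_asymm (Finset.mem_filter.1 h1).2 (Finset.mem_filter.1 h2).2

/-- If `U` is an initial segment of seven cells, eliminating `U` costs at least 58. A cell costs
at least 10, unless its column is new (at least 9) or both its row and its column are new (at
least 7); this happens at most five and four times. -/
theorem IsPerfectElimination.le_sum_card_laterNeighbors {H : SimpleGraph (Fin 4 × Fin 5)}
    {pos : Fin 4 × Fin 5 → ℕ} {U : Finset (Fin 4 × Fin 5)} (hH : rookGraph 4 5 ≤ H)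
    (hpos : IsPerfectElimination H pos) (hU : U.card = 7)
    (hinit : ∀ v ∈ U, ∀ w, pos w < pos v → w ∈ U) :
    58 ≤ ∑ v ∈ U, (laterNeighbors H pos v).card := by
  classical
  let rowNew : Fin 4 × Fin 5 → Prop := fun v => ∀ u, pos u < pos v → u.1 ≠ v.1
  let colNew : Fin 4 × Fin 5 → Prop := fun v => ∀ u, pos u < pos v → u.2 ≠ v.2
  have hr1 : ∀ v, 0 < (linkedRows pos v).card :=
    fun v => Finset.card_pos.2 ⟨_, fst_mem_linkedRows⟩
  have hq1 : ∀ v, 0 < (linkedCols pos v).card :=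
    fun v => Finset.card_pos.2 ⟨_, snd_mem_linkedCols⟩
  have hr4 : ∀ v, (linkedRows pos v).card ≤ 4 :=
    fun v => by simpa using (linkedRows pos v).card_le_univ
  have hq5 : ∀ v, (linkedCols pos v).card ≤ 5 :=
    fun v => by simpa using (linkedCols pos v).card_le_univ
  have hr2 : ∀ v, ¬ colNew v → 2 ≤ (linkedRows pos v).card := by
    intro v hv
    simp only [colNew, not_forall, not_not] at hv
    obtain ⟨u, hu, h⟩ := hv
    exact two_le_card_linkedRows hu h
  have hq2 : ∀ v, ¬ rowNew v → 2 ≤ (linkedCols pos v).card := by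
    intro v hv
    simp only [rowNew, not_forall, not_not] at hv
    obtain ⟨u, hu, h⟩ := hv
    exact two_le_card_linkedCols hu h
  have hc7 : ∀ v ∈ U, (linkedCells pos v).card ≤ 7 := by
    intro v hv
    rw [← hU]
    refine Finset.card_le_card fun x hx => ?_
    rcases (mem_linkedCells.1 hx).1.lt_or_eq with h | h
    · exact hinit v hv x h
    · exact hpos.1 h ▸ hv
  -- With `r` linked rows, `q` linked columns and `c ≤ min (r q) 7` linked cells, the cost
  -- `5 r + 4 q - r q - c` is 7 at `(r, q) = (1, 1)`, 9 at `(1, 2)`, and at least 10 elsewhere.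
  have hcost : ∀ v ∈ U, 10 ≤ (laterNeighbors H pos v).card +
      2 * (if rowNew v ∧ colNew v then 1 else 0) + (if colNew v then 1 else 0) := by
    intro v hv
    have h1 := hpos.le_card_laterNeighbors hH v
    have h2 := card_linkedCells_le (pos := pos) (v := v)
    have h3 := hc7 v hv
    have h4 := hr2 v
    have h5 := hq2 v
    have := hr1 v
    have := hq1 v
    have := hr4 v
    have := hq5 v
    generalize (linkedRows pos v).card = r at *
    generalize (linkedCols pos v).card = q at *
    by_cases hc : colNew v
    · by_cases hr : rowNew v
      · simp only [hr, hc, and_self, if_true]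
        interval_cases r <;> interval_cases q <;> omega
      · have := h5 hr
        simp only [hr, hc, false_and, if_true, if_false]
        interval_cases r <;> interval_cases q <;> omega
    · have := h4 hc
      simp only [hc, and_false, if_false]
      interval_cases r <;> interval_cases q <;> omega
  have hrow : (U.filter rowNew).card ≤ 4 := by
    refine (Finset.card_le_card_of_injOn (t := (Finset.univ : Finset (Fin 4))) Prod.fst
      (fun _ _ => Finset.mem_univ _) ?_).trans (by simp)
    intro x hx y hy hxy
    rcases lt_trichotomy (pos x) (pos y) with h | h | h
    · exact ((Finset.mem_filter.1 hy).2 x h hxy).elim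
    · exact hpos.1 h
    · exact ((Finset.mem_filter.1 hx).2 y h hxy.symm).elim
  have hcol : (U.filter colNew).card ≤ 5 := by
    refine (Finset.card_le_card_of_injOn (t := (Finset.univ : Finset (Fin 5))) Prod.snd
      (fun _ _ => Finset.mem_univ _) ?_).trans (by simp)
    intro x hx y hy hxy
    rcases lt_trichotomy (pos x) (pos y) with h | h | h
    · exact ((Finset.mem_filter.1 hy).2 x h hxy).elim
    · exact hpos.1 h
    · exact ((Finset.mem_filter.1 hx).2 y h hxy.symm).elim
  have hsub : U.filter (fun v => rowNew v ∧ colNew v) ⊆ U.filter rowNew :=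
    fun v hv => Finset.mem_filter.2 ⟨(Finset.mem_filter.1 hv).1, (Finset.mem_filter.1 hv).2.1⟩
  have hboth := Finset.card_le_card hsub
  have hsplit : ∑ v ∈ U, ((laterNeighbors H pos v).card +
      2 * (if rowNew v ∧ colNew v then 1 else 0) + (if colNew v then 1 else 0)) =
      ∑ v ∈ U, (laterNeighbors H pos v).card + 2 * (U.filter fun v => rowNew v ∧ colNew v).card +
        (U.filter colNew).card := by
    rw [Finset.sum_add_distrib, Finset.sum_add_distrib, ← Finset.mul_sum, Finset.card_filter,
      Finset.card_filter]
  have hsum := Finset.card_nsmul_le_sum U _ 10 hcost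
  rw [hsplit, hU, smul_eq_mul] at hsum
  by_cases hfour : (U.filter fun v => rowNew v ∧ colNew v).card = 4
  swap
  · omega
  -- Every new row now comes with a new column, and the first cell whose column is not new
  -- costs at least 11, as all the cells before it lie in distinct columns.
  have heq : U.filter (fun v => rowNew v ∧ colNew v) = U.filter rowNew :=
    Finset.eq_of_subset_of_card_le hsub (by omega)
  have hne : (U.filter fun v => ¬ colNew v).Nonempty := by
    rw [← Finset.card_pos]
    have := Finset.card_filter_add_card_filter_not (s := U) colNew
    omega
  obtain ⟨t, ht, htmin⟩ := Finset.exists_min_image _ pos hne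
  obtain ⟨htU, htcol⟩ := Finset.mem_filter.1 ht
  have htrow : ¬ rowNew t := by
    intro h
    have : t ∈ U.filter rowNew := Finset.mem_filter.2 ⟨htU, h⟩
    rw [← heq] at this
    exact htcol (Finset.mem_filter.1 this).2.2
  have hbefore : ∀ x, pos x < pos t → colNew x := by
    intro x hx
    by_contra hxc
    exact (htmin x (Finset.mem_filter.2 ⟨hinit t htU x hx, hxc⟩)).not_gt hx
  have hcells : ((linkedCells pos t).erase t).card ≤ (linkedCols pos t).card := by
    refine Finset.card_le_card_of_injOn Prod.snd
      (fun x hx => (mem_linkedCells.1 (Finset.mem_of_mem_erase hx)).2.2) ?_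
    have hlt : ∀ x ∈ (linkedCells pos t).erase t, pos x < pos t := fun x hx =>
      lt_of_le_of_ne (mem_linkedCells.1 (Finset.mem_of_mem_erase hx)).1
        fun e => (Finset.mem_erase.1 hx).1 (hpos.1 e)
    intro x hx y hy hxy
    rcases lt_trichotomy (pos x) (pos y) with h | h | h
    · exact (hbefore y (hlt y hy) x h hxy).elim
    · exact hpos.1 h
    · exact (hbefore x (hlt x hx) y h hxy.symm).elim
  have hcells' := Finset.pred_card_le_card_erase (s := linkedCells pos t) (a := t)
  -- Here `c ≤ q + 1` and `r, q ≥ 2`.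
  have ht11 : 11 ≤ (laterNeighbors H pos t).card := by
    have h1 := hpos.le_card_laterNeighbors hH t
    have := hr2 t htcol
    have := hq2 t htrow
    have := hr4 t
    have := hq5 t
    generalize (linkedRows pos t).card = r at *
    generalize (linkedCols pos t).card = q at *
    interval_cases r <;> interval_cases q <;> omega
  have herase := Finset.card_nsmul_le_sum (U.erase t) _ 10
    fun v hv => hcost v (Finset.mem_of_mem_erase hv)
  have hadd := Finset.add_sum_erase U (fun v => (laterNeighbors H pos v).card +
      2 * (if rowNew v ∧ colNew v then 1 else 0) + (if colNew v then 1 else 0)) htU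
  rw [hsplit] at hadd
  rw [Finset.card_erase_of_mem htU, hU, smul_eq_mul] at herase
  omega

/-- A tree decomposition of width at most 10 would give a chordal supergraph with a perfect
elimination order in which every vertex has at most 10 later neighbours. -/
theorem eleven_le_treewidth_rookGraph : 11 ≤ treewidth (rookGraph 4 5) := by
  by_contra hlt
  obtain ⟨D, hD⟩ := exists_treeDecomposition_card_bag_le_treewidth (rookGraph 4 5)
  obtain ⟨H, hH, pos, hpos, hcard⟩ := D.exists_isPerfectElimination hD
  obtain ⟨v, hv⟩ := hpos.exists_eleven_le_card_laterNeighbors hH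
  have := hcard v
  omega

/-- A clique of 13 vertices contributes 78 edges, and eliminating the other seven vertices first
adds at least 58 more. -/
theorem IsTriangulation.le_numEdges_of_lt_treewidth {H : SimpleGraph (Fin 4 × Fin 5)}
    (hH : IsTriangulation (rookGraph 4 5) H) (htw : 11 < treewidth H) : 136 ≤ numEdges H := by
  classical
  obtain ⟨K, hKcard, hK⟩ := hH.2.exists_clique_of_lt_treewidth htw
  obtain ⟨pos, hpos, hlast⟩ := hH.2.exists_isPerfectElimination K hK
  rw [numEdges_eq_sum_card_laterNeighbors H hpos.1, ← Finset.sum_compl_add_sum K]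
  have h1 : 58 ≤ ∑ v ∈ Kᶜ, (laterNeighbors H pos v).card := by
    refine hpos.le_sum_card_laterNeighbors hH.1 (by rw [Finset.card_compl, hKcard]; simp) ?_
    intro v hv w hw
    rw [Finset.mem_compl] at hv ⊢
    exact fun hwK => lt_asymm hw (hlast w hwK v hv)
  have h2 : ∑ v ∈ K, (K.filter fun w => pos v < pos w).card ≤
      ∑ v ∈ K, (laterNeighbors H pos v).card := by
    refine Finset.sum_le_sum fun v hv => Finset.card_le_card fun w hw => ?_
    obtain ⟨hwK, hlt⟩ := Finset.mem_filter.1 hw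
    exact mem_laterNeighbors.2 ⟨hK hv hwK fun e => hlt.ne (congrArg pos e), hlt⟩
  have h3 := sum_card_filter_lt K hpos.1
  rw [hKcard] at h3
  omega

/-! ### The elimination graph of an ordering -/

/-- If being adjacent or equal is transitive, eliminating vertices creates no edges. -/
theorem eliminationGraph_eq_self {V : Type*} (l : List V) {G : SimpleGraph V}
    (hG : ∀ x y z, G.Adj x y → G.Adj y z → x ≠ z → G.Adj x z) : eliminationGraph G l = G := by
  induction l generalizing G with
  | nil => rfl
  | cons v l ih =>
    have hle : eliminate G v ≤ G := by
      rintro x y ⟨hxy, -, -, h | ⟨h1, h2⟩⟩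
      · exact h
      · exact hG x v y h1 h2 hxy
    have h : eliminationGraph (eliminate G v) l = eliminate G v := by
      refine ih ?_
      rintro x y z hxy hyz hxz
      exact ⟨hxz, hxy.2.1, hyz.2.2.1, Or.inl (hG x y z (hle hxy) (hle hyz) hxz)⟩
    rw [eliminationGraph, h]
    exact sup_eq_left.2 hle

/-- Once the graph that is left is a disjoint union of cliques, the order in which the remaining
vertices are eliminated does not matter. -/
theorem eliminationGraph_append_eq {V : Type*} (l₁ l₂ : List V) {G : SimpleGraph V}
    (hG : ∀ x y z, (l₁.foldl eliminate G).Adj x y → (l₁.foldl eliminate G).Adj y z → x ≠ z →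
      (l₁.foldl eliminate G).Adj x z) :
    eliminationGraph G (l₁ ++ l₂) = eliminationGraph G l₁ := by
  induction l₁ generalizing G with
  | nil => exact eliminationGraph_eq_self l₂ hG
  | cons v l ih => rw [List.cons_append, eliminationGraph, eliminationGraph, ih hG]

theorem le_eliminationGraph {V : Type*} (G : SimpleGraph V) (l : List V) :
    G ≤ eliminationGraph G l := by
  cases l with
  | nil => exact le_rfl
  | cons v l => exact le_sup_left

theorem not_adj_eliminationGraph {V : Type*} (l : List V) {G : SimpleGraph V} {v : V}
    (hG : ∀ x, ¬ G.Adj v x) (x : V) : ¬ (eliminationGraph G l).Adj v x := by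
  induction l generalizing G with
  | nil => exact hG x
  | cons u l ih =>
    rintro (h | h)
    · exact hG x h
    · refine ih ?_ h
      rintro y ⟨-, -, -, h | ⟨h, -⟩⟩
      · exact hG y h
      · exact hG u h

/-- The elimination graph is ordered perfectly by the elimination: the neighbours that a vertex has
when it is eliminated are made adjacent. -/
theorem eliminationGraph_adj_trans {V : Type*} [BEq V] [LawfulBEq V] (l : List V) (G : SimpleGraph V)
    (hG : ∀ x y, G.Adj x y → x ∈ l) {v x y : V} (hx : (eliminationGraph G l).Adj v x)
    (hy : (eliminationGraph G l).Adj v y) (hvx : l.idxOf v < l.idxOf x)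
    (hvy : l.idxOf v < l.idxOf y) (hxy : x ≠ y) : (eliminationGraph G l).Adj x y := by
  induction l generalizing G with
  | nil => simp at hvx
  | cons u l ih =>
    have hu : ∀ z, (u :: l).idxOf v < (u :: l).idxOf z → u ≠ z := by
      rintro z hz rfl
      simp at hz
    have hux := hu x hvx
    have huy := hu y hvy
    have hlift : ∀ a b, u ≠ a → u ≠ b → (eliminationGraph G (u :: l)).Adj a b →
        (eliminationGraph (eliminate G u) l).Adj a b := by
      rintro a b ha hb (h | h)
      · exact le_eliminationGraph _ _ ⟨h.ne, ha.symm, hb.symm, Or.inl h⟩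
      · exact h
    by_cases huv : u = v
    · subst huv
      have hiso : ∀ z, ¬ (eliminationGraph (eliminate G u) l).Adj u z :=
        not_adj_eliminationGraph l fun z h => h.2.1 rfl
      refine Or.inr (le_eliminationGraph _ _ ⟨hxy, hux.symm, huy.symm, Or.inr ⟨?_, ?_⟩⟩)
      · exact (hx.resolve_right (hiso x)).symm
      · exact hy.resolve_right (hiso y)
    · rw [List.idxOf_cons_ne _ huv, List.idxOf_cons_ne _ hux] at hvx
      rw [List.idxOf_cons_ne _ huv, List.idxOf_cons_ne _ huy] at hvy
      refine Or.inr (ih (eliminate G u) ?_ (hlift v x huv hux hx) (hlift v y huv huy hy)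
        (Nat.lt_of_succ_lt_succ hvx) (Nat.lt_of_succ_lt_succ hvy))
      rintro a _ ⟨-, ha, -, h | ⟨h, -⟩⟩ <;>
        exact (List.mem_cons.1 (hG _ _ h)).resolve_left ha

theorem IsEliminationOrdering.isPerfectElimination {V : Type*} [BEq V] [LawfulBEq V]
    {l : List V} (hl : IsEliminationOrdering l) (G : SimpleGraph V) :
    IsPerfectElimination (eliminationGraph G l) fun v => l.idxOf v :=
  ⟨fun a _ h => (List.idxOf_inj (hl.2 a)).1 h, fun _ _ _ hx hy hpx hpy hxy =>
    eliminationGraph_adj_trans l G (fun x _ _ => hl.2 x) hx hy hpx hpy hxy⟩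

instance {V : Type*} [DecidableEq V] (G : SimpleGraph V) [DecidableRel G.Adj] (v : V) :
    DecidableRel (eliminate G v).Adj :=
  fun x y => inferInstanceAs
    (Decidable (x ≠ y ∧ x ≠ v ∧ y ≠ v ∧ (G.Adj x y ∨ (G.Adj x v ∧ G.Adj v y))))

instance (m n : ℕ) : DecidableRel (rookGraph m n).Adj :=
  fun _ _ => decidable_of_iff' _ rookGraph_adj

instance decidableRelFoldlEliminate {V : Type*} [DecidableEq V] :
    ∀ (l : List V) (G : SimpleGraph V) [DecidableRel G.Adj],
      DecidableRel (l.foldl eliminate G).Adj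
  | [], _, h => h
  | v :: l, G, _ => decidableRelFoldlEliminate l (eliminate G v)

instance decidableRelEliminationGraph {V : Type*} [DecidableEq V] :
    ∀ (l : List V) (G : SimpleGraph V) [DecidableRel G.Adj],
      DecidableRel (eliminationGraph G l).Adj
  | [], _, h => h
  | v :: l, G, _ => fun x y =>
    have := decidableRelEliminationGraph l (eliminate G v)
    inferInstanceAs (Decidable (G.Adj x y ∨ (eliminationGraph (eliminate G v) l).Adj x y))

/-! ### The elimination graph of the `4 × 5` rook's graph -/

/-- The cells of the two squares `{0, 1} × {0, 1}` and `{2, 3} × {2, 3}`, their diagonals first. -/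
def rookPrefix : List (Fin 4 × Fin 5) :=
  [(0, 0), (1, 1), (2, 2), (3, 3), (0, 1), (2, 3), (1, 0), (3, 2)]

/-- The rook's graph with the fill edges that arise when `rookPrefix` is eliminated. -/
def rookFill : SimpleGraph (Fin 4 × Fin 5) := eliminationGraph (rookGraph 4 5) rookPrefix

instance : DecidableRel rookFill.Adj :=
  inferInstanceAs (DecidableRel (eliminationGraph (rookGraph 4 5) rookPrefix).Adj)

/-- What the elimination of `rookPrefix` leaves of the rook's graph. -/
def rookRemainder : SimpleGraph (Fin 4 × Fin 5) := rookPrefix.foldl eliminate (rookGraph 4 5)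

instance : DecidableRel rookRemainder.Adj :=
  inferInstanceAs (DecidableRel (rookPrefix.foldl eliminate (rookGraph 4 5)).Adj)

/-- The twelve cells outside `rookPrefix` end up pairwise adjacent. -/
theorem rookRemainder_adj : ∀ x y,
    rookRemainder.Adj x y ↔ x ≠ y ∧ x ∉ rookPrefix ∧ y ∉ rookPrefix := by
  decide +kernel

theorem eliminationGraph_rookPrefix_append (l : List (Fin 4 × Fin 5)) :
    eliminationGraph (rookGraph 4 5) (rookPrefix ++ l) = rookFill := by
  refine eliminationGraph_append_eq _ _ fun x y z hxy hyz hxz => ?_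
  exact (rookRemainder_adj x z).2
    ⟨hxz, ((rookRemainder_adj x y).1 hxy).2.1, ((rookRemainder_adj y z).1 hyz).2.2⟩

/-- The elimination ordering that continues `rookPrefix` lexicographically. -/
def rookOrdering : List (Fin 4 × Fin 5) :=
  rookPrefix ++ (List.finRange 4 ×ˢ List.finRange 5).filter fun x => x ∉ rookPrefix

theorem isEliminationOrdering_rookOrdering : IsEliminationOrdering rookOrdering := by
  constructor <;> decide +kernel

theorem isPerfectElimination_rookFill :
    IsPerfectElimination rookFill fun v => rookOrdering.idxOf v := by
  rw [← eliminationGraph_rookPrefix_append]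
  exact isEliminationOrdering_rookOrdering.isPerfectElimination _

theorem laterNeighbors_eq_filter {V : Type*} [Fintype V] (H : SimpleGraph V)
    [DecidableRel H.Adj] (pos : V → ℕ) (v : V) :
    laterNeighbors H pos v = Finset.univ.filter fun w => H.Adj v w ∧ pos v < pos w := by
  ext w
  simp [mem_laterNeighbors]

theorem isTriangulation_rookFill : IsTriangulation (rookGraph 4 5) rookFill :=
  ⟨le_eliminationGraph _ _, isPerfectElimination_rookFill.isChordalGraph⟩

theorem treewidth_rookFill : treewidth rookFill = 11 := by
  refine le_antisymm (isPerfectElimination_rookFill.treewidth_le ?_)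
    (eleven_le_treewidth_rookGraph.trans (treewidth_mono isTriangulation_rookFill.1))
  simp only [laterNeighbors_eq_filter]
  decide +kernel

theorem numEdges_rookFill : numEdges rookFill = 136 := by
  rw [numEdges_eq_sum_card_laterNeighbors _ isPerfectElimination_rookFill.1]
  simp only [laterNeighbors_eq_filter]
  decide +kernel

theorem numEdges_rookGraph : numEdges (rookGraph 4 5) = 70 := by
  rw [numEdges_eq_sum_card_laterNeighbors _ isPerfectElimination_rookFill.1]
  simp only [laterNeighbors_eq_filter]
  decide +kernel

theorem numFillEdges_rookFill : numFillEdges (rookGraph 4 5) rookFill = 66 := by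
  have h := Set.ncard_sdiff_add_ncard_of_subset (edgeSet_mono isTriangulation_rookFill.1)
  have h1 : (rookFill.edgeSet).ncard = 136 := numEdges_rookFill
  have h2 : ((rookGraph 4 5).edgeSet).ncard = 70 := numEdges_rookGraph
  rw [numFillEdges]
  omega

theorem treewidth_rookGraph : treewidth (rookGraph 4 5) = 11 :=
  le_antisymm ((treewidth_mono isTriangulation_rookFill.1).trans treewidth_rookFill.le)
    eleven_le_treewidth_rookGraph

/-- A minimum triangulation of treewidth above 11 has at least as many edges as `rookFill`, which is
then a minimum triangulation as well. -/
theorem exists_isMinimumTriangulation_rookGraph :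
    ∃ H, IsMinimumTriangulation (rookGraph 4 5) H ∧ treewidth H = 11 := by
  obtain ⟨H, hH, hmin⟩ := Set.exists_min_image {H | IsTriangulation (rookGraph 4 5) H} numEdges
    (Set.toFinite _) ⟨_, isTriangulation_rookFill⟩
  rcases le_or_gt (treewidth H) 11 with hle | hlt
  · exact ⟨H, ⟨hH, hmin⟩, le_antisymm hle
      (eleven_le_treewidth_rookGraph.trans (treewidth_mono hH.1))⟩
  · exact ⟨rookFill, ⟨isTriangulation_rookFill, fun H' hH' => numEdges_rookFill.le.trans
      ((hH.le_numEdges_of_lt_treewidth hlt).trans (hmin H' hH'))⟩, treewidth_rookFill⟩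

end SimpleGraph

theorem mainTheorem2 :
    SimpleGraph.tau (SimpleGraph.rookGraph 4 5) = 0 ∧
    (∃ H : SimpleGraph (Fin 4 × Fin 5),
      SimpleGraph.IsMinimumTriangulation (SimpleGraph.rookGraph 4 5) H ∧
      SimpleGraph.treewidth H = SimpleGraph.treewidth (SimpleGraph.rookGraph 4 5)) ∧
    SimpleGraph.treewidth (SimpleGraph.rookGraph 4 5) = 11 ∧
    ∀ l β : List (Fin 4 × Fin 5),
      β = [(0, 0), (1, 1), (2, 2), (3, 3), (0, 1), (2, 3), (1, 0), (3, 2)] ++ l →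
      SimpleGraph.IsEliminationOrdering β →
      SimpleGraph.IsTriangulation (SimpleGraph.rookGraph 4 5)
        (SimpleGraph.eliminationGraph (SimpleGraph.rookGraph 4 5) β) ∧
      SimpleGraph.treewidth (SimpleGraph.eliminationGraph (SimpleGraph.rookGraph 4 5) β) = 11 ∧
      SimpleGraph.numFillEdges (SimpleGraph.rookGraph 4 5)
        (SimpleGraph.eliminationGraph (SimpleGraph.rookGraph 4 5) β) = 66 ∧
      ∀ H : SimpleGraph (Fin 4 × Fin 5),
        SimpleGraph.IsTriangulation (SimpleGraph.rookGraph 4 5) H →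
        11 < SimpleGraph.treewidth H →
        SimpleGraph.numEdges (SimpleGraph.eliminationGraph (SimpleGraph.rookGraph 4 5) β) ≤
          SimpleGraph.numEdges H := by
  obtain ⟨H, hH, htw⟩ := SimpleGraph.exists_isMinimumTriangulation_rookGraph
  refine ⟨?_, ⟨H, hH, htw.trans SimpleGraph.treewidth_rookGraph.symm⟩,
    SimpleGraph.treewidth_rookGraph, ?_⟩
  · rw [SimpleGraph.tau, SimpleGraph.treewidth_rookGraph, sub_eq_zero, Nat.cast_inj]
    refine le_antisymm (Nat.sInf_le ⟨H, hH, htw⟩) (le_csInf ⟨_, H, hH, rfl⟩ ?_)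
    rintro _ ⟨H', hH', rfl⟩
    exact SimpleGraph.eleven_le_treewidth_rookGraph.trans (SimpleGraph.treewidth_mono hH'.1.1)
  · rintro l β rfl -
    have h : SimpleGraph.eliminationGraph (SimpleGraph.rookGraph 4 5)
        ([(0, 0), (1, 1), (2, 2), (3, 3), (0, 1), (2, 3), (1, 0), (3, 2)] ++ l) =
        SimpleGraph.rookFill := SimpleGraph.eliminationGraph_rookPrefix_append l
    rw [h]
    exact ⟨SimpleGraph.isTriangulation_rookFill, SimpleGraph.treewidth_rookFill,
      SimpleGraph.numFillEdges_rookFill, fun H' hH' hlt =>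
        SimpleGraph.numEdges_rookFill.le.trans (hH'.le_numEdges_of_lt_treewidth hlt)⟩
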